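/- Consider two clients $j\in\{1,2\}$ served by an access point over slotted time, where a frame consists of $\tau\ge 1$ consecutive slots. At the beginning of each frame one packet is generated for each client; a packet not delivered by the end of its frame is dropped. In each slot the access point can transmit one packet, and, whatever happened before, a transmission to client $j$ succeeds with probability $p_j\in(0,1]$; failed packets may be retransmitted within the frame. Let $\gamma_1,\gamma_2$ be independent, $\gamma_j$ geometric on $\{1,2,\dots\}$ with parameter $p_j$, and for $S\subseteq\{1,2\}$ put $I_S=\frac1\tau E\big[(\tau-\sum_{i\in S}\gamma_i)^+\big]$. Let $q=(q_1,q_2)$ be a vector of required timely throughputs (packets per frame) that is feasible, i.e. $\sum_{i\in S}\frac{q_i}{\tau p_i}\le 1-I_S$ for every $S\subseteq\{1,2\}$, and that lies on exactly one of the bounding hyperplanes with $S\neq\emptyset$, namely $$\frac{q_1}{p_1}+\frac{q_2}{p_2}=\tau\,(1-I_{\{1,2\}}),\qquad \frac{q_j}{p_j}\neq\tau(1-I_{\{j\}})\quad(j=1,2).$$ Let $d_j(t)=tq_j-\#\{\text{packets of client } j \text{ delivered in frames } 0,\dots,t-1\}$ be the debt of client $j$. Under the maximum weighted debt first policy, at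 the beginning of each frame $t$ the clients are ordered by decreasing $d_j(t)/p_j$ (ties broken by any non-anticipating, possibly randomized, rule), and during the frame they are served in that order: the first client's packet is transmitted until it is delivered, then the second client's packet, and after both are delivered the access point idles. Let $\sigma_I^2$ be the variance of the number of idle slots in a frame (it is the same for every frame), let $c_j=\frac{q_j(1-p_j)}{p_j^2}$ and $\varphi(t)=\sqrt{2t\log\log t}$. Then, almost surely, for $j=1,2$, $$\limsup_{t\to\infty}\frac{d_j(t)}{\varphi(t)}\le p_j\,\frac{\sqrt{c_1}+\sqrt{c_2}+\sigma_I}{2}.$$ -/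

import Mathlib

open MeasureTheory ProbabilityTheory Filter

/-! Two clients (indexed by `Fin 2`) served over unreliable channels in frames of `τ` slots.
Slot `s < τ` of frame `k` is the slot number `k * τ + s`. -/

namespace TwoClients

/-- The expected proportion of idle time in a frame when the set of clients is `S`:
`I_S = (1/τ) E[(τ - ∑_{i ∈ S} γ_i)⁺]`, where `γ_i` are independent and `γ_i` is the number of
attempts (failures plus one) needed to deliver a packet of client `i`. -/
noncomputable def idleProportion (τ : ℕ) (p : Fin 2 → unitInterval) (S : Finset (Fin 2)) : ℝ :=
  (1 / (τ : ℝ)) *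
    ∫ n : Fin 2 → ℕ, max ((τ : ℝ) - ∑ i ∈ S, ((n i : ℝ) + 1)) 0
      ∂(Measure.pi fun i => geometricMeasure (p i))

/-- The rate region: the feasible vectors of timely throughputs. -/
def IsFeasible (τ : ℕ) (p : Fin 2 → unitInterval) (q : Fin 2 → ℝ) : Prop :=
  ∀ S : Finset (Fin 2), ∑ i ∈ S, q i / ((τ : ℝ) * (p i : ℝ)) ≤ 1 - idleProportion τ p S

/-- The client that is transmitted to in a slot, when client `f` has priority in the frame and
`A` is the set of clients whose packet is still undelivered; `none` means that the slot is idle. -/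
def target (f : Fin 2) (A : Finset (Fin 2)) : Option (Fin 2) :=
  if f ∈ A then some f else if f.rev ∈ A then some f.rev else none

/-- The set of clients whose packet is still undelivered after the first `s` slots of a frame in
which client `f` has priority, where `x r` tells whether the transmission in slot `r` of the frame
succeeds. -/
def pending (f : Fin 2) (x : ℕ → Bool) : ℕ → Finset (Fin 2)
  | 0 => Finset.univ
  | s + 1 =>
    match target f (pending f x s) with
    | none => pending f x s
    | some j => if x s then (pending f x s).erase j else pending f x s

section Dynamics

variable {Ω : Type*} (τ : ℕ) (first : ℕ → Ω → Fin 2) (success : ℕ → Ω → Bool)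

/-- Undelivered clients in frame `k` after its first `s` slots. Here `first k` is the client with
priority in frame `k`, and `success n` tells whether the transmission made in slot `n` succeeds
(it is irrelevant when slot `n` is idle). -/
def pendingAt (k s : ℕ) (ω : Ω) : Finset (Fin 2) :=
  pending (first k ω) (fun r => success (k * τ + r) ω) s

/-- The client transmitted to in slot `s` of frame `k` (`none` if the slot is idle). -/
def served (k s : ℕ) (ω : Ω) : Option (Fin 2) :=
  target (first k ω) (pendingAt τ first success k s ω)

/-- The time `i(k)` spent idling in frame `k`. -/
def idleTime (k : ℕ) (ω : Ω) : ℝ :=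
  (((Finset.range τ).filter fun s => served τ first success k s ω = none).card : ℝ)

/-- The debt `d_j(t)`: `t q_j` minus the number of packets delivered for client `j` in the frames
`0, …, t - 1`. -/
def debt (q : Fin 2 → ℝ) (j : Fin 2) (t : ℕ) (ω : Ω) : ℝ :=
  (t : ℝ) * q j -
    (((Finset.range t).filter fun k => j ∉ pendingAt τ first success k τ ω).card : ℝ)

/-- The system run under the maximum weighted debt first policy. `ℱ n` is the information available
just before slot `n`. Ties between weighted debts may be broken by any non-anticipating rule,
possibly randomized. -/
structure IsMWDF [MeasurableSpace Ω] (μ : Measure Ω) (ℱ : Filtration ℕ ‹MeasurableSpace Ω›)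
    (p : Fin 2 → unitInterval) (q : Fin 2 → ℝ) : Prop where
  /-- The outcome of slot `n` is known after slot `n`. -/
  measurable_success : ∀ n, Measurable[ℱ (n + 1)] (success n)
  /-- The priority order of a frame is chosen at the beginning of that frame. -/
  measurable_first : ∀ k, Measurable[ℱ (k * τ)] (first k)
  /-- A transmission to client `j` succeeds with probability `p j`, whatever the past. -/
  channel : ∀ k s, s < τ → ∀ j : Fin 2,
    μ[(fun ω => if served τ first success k s ω = some j ∧ success (k * τ + s) ω = true
        then (1 : ℝ) else 0) | ℱ (k * τ + s)]
      =ᵐ[μ] fun ω => if served τ first success k s ω = some j then (p j : ℝ) else 0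
  /-- Priority goes to a client with the largest weighted debt `d_j / p_j`. -/
  max_debt : ∀ k ω j, debt τ first success q j k ω / (p j : ℝ) ≤
    debt τ first success q (first k ω) k ω / (p (first k ω) : ℝ)

end Dynamics

/-- The normalization `φ(t) = √(2 t log log t)`. -/
noncomputable def phi (t : ℕ) : ℝ := √(2 * (t : ℝ) * Real.log (Real.log (t : ℝ)))

/-- `c_j = q_j (1 - p_j) / p_j²`. -/
noncomputable def cCoef (p : Fin 2 → unitInterval) (q : Fin 2 → ℝ) (j : Fin 2) : ℝ :=
  q j * (1 - (p j : ℝ)) / (p j : ℝ) ^ 2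

end TwoClients

/-! Counted in transmissions, the weighted debt of client `j` is `t * (q j / p j)` plus a martingale
(`noise`) minus the attempts made for `j`. Attempts and idle slots together fill all `t * τ` slots,
so on the hyperplane the linear terms cancel in the sum of the two weighted debts: what remains is
the centred idle time plus two noise martingales (`debt_add_debt`). Each of the three is a
martingale with bounded increments, and the law of the iterated logarithm (`lil_upper`) gives them
the constants `√c_1`, `√c_2` and `σ_I`. The three bounds are simply added, without using the joint
behaviour of the martingales.

The factor 1/2 comes from state space collapse. The singleton constraints are strict, so the client
with priority receives on average more attempts than it requires. Hence the difference of the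
weighted debts drifts towards 0 at a rate bounded away from 0, and is `O(log t)`
(`eventually_abs_le_log_of_drift`, `IsMWDF.eventually_abs_debtGap_le`). Each weighted debt is then
half the sum, up to an error negligible against `phi`.

The quadratic variation of the noise is `(1 - p j) / p j` times the number of attempts, which is
random, so its growth rate is found by bootstrapping. The trivial bound of `τ` attempts per frame
makes all martingales `O(phi t)`; with the collapse, no debt is then below `-ε t`, so attempts
number at most `(q j / p j + δ) * t`. This turns the rate into `c_j` (`IsMWDF.noise_lil_sharp`).

Conditional means over a frame come from the Markov chain of pending packets, matched with a
first-attempt recursion for geometric variables (`idleMean_succ`). -/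

namespace TwoClients

/-! ### Bounded measurable functions, used as test functions -/

section Bounded

variable {Ω : Type*}

/-- Bounded functions measurable with respect to `m`. -/
def BddMeas (m : MeasurableSpace Ω) (f : Ω → ℝ) : Prop :=
  Measurable[m] f ∧ ∃ C, ∀ ω, |f ω| ≤ C

variable {m m' : MeasurableSpace Ω} {f g : Ω → ℝ}

lemma BddMeas.mono (h : m ≤ m') (hf : BddMeas m f) : BddMeas m' f :=
  ⟨hf.1.mono h le_rfl, hf.2⟩

lemma bddMeas_const (c : ℝ) : BddMeas m (fun _ => c) :=
  ⟨measurable_const, |c|, fun _ => le_rfl⟩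

lemma BddMeas.add (hf : BddMeas m f) (hg : BddMeas m g) : BddMeas m (fun ω => f ω + g ω) := by
  obtain ⟨hf, C, hC⟩ := hf
  obtain ⟨hg, D, hD⟩ := hg
  exact ⟨hf.add hg, C + D, fun ω => (abs_add_le _ _).trans (add_le_add (hC ω) (hD ω))⟩

lemma BddMeas.mul (hf : BddMeas m f) (hg : BddMeas m g) : BddMeas m (fun ω => f ω * g ω) := by
  obtain ⟨hf, C, hC⟩ := hf
  obtain ⟨hg, D, hD⟩ := hg
  refine ⟨hf.mul hg, C * D, fun ω => ?_⟩
  rw [abs_mul]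
  exact mul_le_mul (hC ω) (hD ω) (abs_nonneg _) ((abs_nonneg _).trans (hC ω))

lemma BddMeas.const_mul (hf : BddMeas m f) (c : ℝ) : BddMeas m (fun ω => c * f ω) :=
  (bddMeas_const c).mul hf

lemma BddMeas.neg (hf : BddMeas m f) : BddMeas m (fun ω => - f ω) := by
  simpa using hf.const_mul (-1)

lemma BddMeas.sub (hf : BddMeas m f) (hg : BddMeas m g) : BddMeas m (fun ω => f ω - g ω) := by
  simpa [sub_eq_add_neg] using hf.add hg.neg

lemma BddMeas.sq (hf : BddMeas m f) : BddMeas m (fun ω => f ω ^ 2) := by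
  simpa [_root_.sq] using hf.mul hf

lemma BddMeas.sum {ι : Type*} (s : Finset ι) {F : ι → Ω → ℝ} (hF : ∀ i ∈ s, BddMeas m (F i)) :
    BddMeas m (fun ω => ∑ i ∈ s, F i ω) := by
  classical
  induction s using Finset.induction_on with
  | empty => simpa using bddMeas_const 0
  | insert a s ha ih =>
    simp only [Finset.sum_insert ha]
    exact (hF a (by simp)).add (ih fun i hi => hF i (by simp [hi]))

lemma BddMeas.exp (hf : BddMeas m f) : BddMeas m (fun ω => Real.exp (f ω)) := by
  obtain ⟨hf, C, hC⟩ := hf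
  refine ⟨hf.exp, Real.exp C, fun ω => ?_⟩
  rw [Real.abs_exp]
  exact Real.exp_le_exp.2 ((le_abs_self _).trans (hC ω))

lemma BddMeas.abs (hf : BddMeas m f) : BddMeas m (fun ω => |f ω|) :=
  ⟨hf.1.abs, hf.2.imp fun C hC ω => by simpa using hC ω⟩

/-- A function of finitely many values of a measurable discrete quantity. -/
lemma BddMeas.of_finite {α : Type*} [Finite α] [MeasurableSpace α] [DiscreteMeasurableSpace α]
    {X : Ω → α} (hX : Measurable[m] X) (h : α → ℝ) : BddMeas m (fun ω => h (X ω)) := by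
  obtain ⟨C, hC⟩ := (Set.finite_range fun a => |h a|).bddAbove
  exact ⟨(Measurable.of_discrete (f := h)).comp hX, C, fun ω => hC ⟨X ω, rfl⟩⟩

lemma bddMeas_indicator {s : Set Ω} [DecidablePred (· ∈ s)] (hs : MeasurableSet[m] s) :
    BddMeas m (fun ω => if ω ∈ s then (1 : ℝ) else 0) := by
  refine ⟨Measurable.ite hs measurable_const measurable_const, 1, fun ω => ?_⟩
  dsimp only
  split_ifs <;> simp

lemma BddMeas.integrable [mΩ : MeasurableSpace Ω] {μ : Measure Ω} [IsFiniteMeasure μ]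
    (hm : m ≤ mΩ) (hf : BddMeas m f) : Integrable f μ := by
  obtain ⟨hf, C, hC⟩ := hf
  exact Integrable.of_bound (hf.mono hm le_rfl).aestronglyMeasurable C
    (Eventually.of_forall fun ω => by simpa using hC ω)

end Bounded

/-! ### Weak conditional means, and the maximal inequalities of Ville and Freedman -/

section CondMean

variable {Ω : Type*}

/-- `g` has the same integral as `f` against all bounded `m`-measurable functions: the weak form
of `μ[f | m] = μ[g | m]`. -/
def SameCondMean {mΩ : MeasurableSpace Ω} (μ : Measure Ω) (m : MeasurableSpace Ω)
    (f g : Ω → ℝ) : Prop :=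
  ∀ Z, BddMeas m Z → ∫ ω, Z ω * f ω ∂μ = ∫ ω, Z ω * g ω ∂μ

variable {m mΩ : MeasurableSpace Ω} {μ : Measure Ω} [IsProbabilityMeasure μ] {f g : Ω → ℝ}

lemma sameCondMean_of_condExp (hm : m ≤ mΩ) (hf : Integrable f μ) (h : μ[f | m] =ᵐ[μ] g) :
    SameCondMean μ m f g := by
  rintro Z ⟨hZ, C, hC⟩
  have hZf : Integrable (Z * f) μ :=
    hf.bdd_mul (hZ.mono hm le_rfl).aestronglyMeasurable
      (Eventually.of_forall fun ω => by simpa using hC ω)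
  have h1 := condExp_mul_of_stronglyMeasurable_left (μ := μ) hZ.stronglyMeasurable hZf hf
  calc ∫ ω, Z ω * f ω ∂μ = ∫ ω, (μ[Z * f | m]) ω ∂μ := (integral_condExp hm).symm
    _ = ∫ ω, Z ω * g ω ∂μ := by
      refine integral_congr_ae ?_
      filter_upwards [h1, h] with ω h1 h2
      rw [h1, Pi.mul_apply, h2]

lemma nonneg_of_forall_abs_le (μ : Measure Ω) [IsProbabilityMeasure μ] {C : ℝ}
    (hf : ∀ ω, |f ω| ≤ C) : 0 ≤ C := by
  obtain ⟨ω⟩ := nonempty_of_isProbabilityMeasure μ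
  exact (abs_nonneg _).trans (hf ω)

/-- Ville's maximal inequality. -/
lemma measure_exists_ge_le {G : Filtration ℕ mΩ} {M : ℕ → Ω → ℝ}
    (hM : ∀ n, BddMeas (G n) (M n)) (hM0 : ∀ n ω, 0 ≤ M n ω) (hM1 : ∀ ω, M 0 ω ≤ 1)
    (hsuper : ∀ n Z, BddMeas (G n) Z → (∀ ω, 0 ≤ Z ω) →
      ∫ ω, Z ω * M (n + 1) ω ∂μ ≤ ∫ ω, Z ω * M n ω ∂μ) {a : ℝ} (ha : 0 < a) :
    μ {ω | ∃ n, a ≤ M n ω} ≤ ENNReal.ofReal a⁻¹ := by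
  classical
  let A : ℕ → Set Ω := fun n => {ω | ∃ k ≤ n, a ≤ M k ω}
  have hA : ∀ n, MeasurableSet[G n] (A n) := by
    intro n
    have : A n = ⋃ k ∈ Set.Iic n, {ω | a ≤ M k ω} := by ext; simp [A]
    rw [this]
    refine MeasurableSet.biUnion (Set.finite_Iic n).countable fun k hk => ?_
    exact measurableSet_le measurable_const ((hM k).1.mono (G.mono hk) le_rfl)
  let Z : ℕ → Ω → ℝ := fun n ω => if ω ∈ A n then (1 : ℝ) else 0
  have hZ : ∀ n, BddMeas (G n) (Z n) := fun n => bddMeas_indicator (hA n)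
  have hY : ∀ n, BddMeas (G n) (fun ω => 1 - Z n ω) := fun n => (bddMeas_const 1).sub (hZ n)
  have hY0 : ∀ n ω, 0 ≤ 1 - Z n ω := by
    intro n ω; simp only [Z]; split_ifs <;> simp
  have hI : ∀ n k, n ≤ k → BddMeas (G k) (fun ω => (1 - Z n ω) * M k ω) := fun n k h =>
    ((hY n).mono (G.mono h)).mul (hM k)
  -- This bounds the mean of the process stopped on reaching level `a`, with the stopped value
  -- lowered to `a`. The weight `1 - Z n` is known at time `n`, so the supermartingale property
  -- applies to it.
  have key : ∀ n, ∫ ω, (1 - Z n ω) * M n ω ∂μ + a * ∫ ω, Z n ω ∂μ ≤ 1 := by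
    intro n
    induction n with
    | zero =>
      rw [← integral_const_mul, ← integral_add ((hI 0 0 le_rfl).integrable (G.le _))
        (((hZ 0).const_mul a).integrable (G.le _))]
      calc _ ≤ ∫ _ω, (1 : ℝ) ∂μ := by
            refine integral_mono (((hI 0 0 le_rfl).add ((hZ 0).const_mul a)).integrable (G.le _))
              (integrable_const _) fun ω => ?_
            have := hM1 ω
            by_cases h : ω ∈ A 0
            · have h' : a ≤ M 0 ω := by simpa [A] using h
              simp only [Z, h, if_true]; linarith
            · simp only [Z, h, if_false]; linarith
        _ = 1 := by simp
    | succ n ih =>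
      refine le_trans ?_ (le_trans (add_le_add_left (hsuper n _ (hY n) (hY0 n)) _) ih)
      rw [← integral_const_mul, ← integral_const_mul,
        ← integral_add ((hI _ _ le_rfl).integrable (G.le _))
        (((hZ _).const_mul a).integrable (G.le _)),
        ← integral_add ((hI _ _ n.le_succ).integrable (G.le _))
        (((hZ _).const_mul a).integrable (G.le _))]
      refine integral_mono (((hI _ _ le_rfl).add ((hZ _).const_mul a)).integrable (G.le _))
        ((((hI _ _ n.le_succ)).add
          (((hZ n).mono (G.mono n.le_succ)).const_mul a)).integrable (G.le _)) fun ω => ?_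
      by_cases h : ω ∈ A n
      · have h' : ω ∈ A (n + 1) := by
          obtain ⟨k, hk, h⟩ := h
          exact ⟨k, hk.trans n.le_succ, h⟩
        simp [Z, h, h']
      · by_cases h' : ω ∈ A (n + 1)
        · have h2 : a ≤ M (n + 1) ω := by
            obtain ⟨k, hk, h'⟩ := h'
            rcases Nat.le_succ_iff.1 hk with hk | rfl
            · exact absurd ⟨k, hk, h'⟩ h
            · exact h'
          simp [Z, h, h', h2]
        · simp [Z, h, h']
  have hAn : ∀ n, μ (A n) ≤ ENNReal.ofReal a⁻¹ := by
    intro n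
    have h1 : ∫ ω, Z n ω ∂μ = μ.real (A n) := by
      have : Z n = (A n).indicator 1 := by
        ext ω; simp [Z, Set.indicator_apply]
      rw [this, integral_indicator_one (G.le _ _ (hA n))]
    have h2 : 0 ≤ ∫ ω, (1 - Z n ω) * M n ω ∂μ :=
      integral_nonneg fun ω => mul_nonneg (hY0 n ω) (hM0 n ω)
    have h3 := key n
    rw [h1] at h3
    rw [← ofReal_measureReal]
    refine ENNReal.ofReal_le_ofReal ?_
    rw [← one_div, le_div_iff₀ ha]
    linarith
  have hU : {ω | ∃ n, a ≤ M n ω} = ⋃ n, A n := by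
    ext ω
    simp only [Set.mem_ofPred_eq, Set.mem_iUnion, A]
    exact ⟨fun ⟨n, h⟩ => ⟨n, n, le_rfl, h⟩, fun ⟨_, k, _, h⟩ => ⟨k, h⟩⟩
  have hmono : Monotone A := fun n k h ω ⟨i, hi, hω⟩ => ⟨i, hi.trans h, hω⟩
  rw [hU, hmono.measure_iUnion]
  exact iSup_le hAn

/-- The cubic Taylor remainder is at most `2/9 * |y|^3`, hence at most `c/2 * y^2`. The quadratic
coefficient tends to the exact 1/2 as `c → 0`, which the sharp constant in the iterated logarithm
requires. -/
lemma exp_le_quadratic {y c : ℝ} (hy : |y| ≤ c) (hc : c ≤ 1) :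
    Real.exp y ≤ 1 + y + (1 + c) / 2 * y ^ 2 := by
  have h := Real.exp_bound (hy.trans hc) (n := 3) (by norm_num)
  simp only [Finset.sum_range_succ, Finset.sum_range_zero] at h
  norm_num [Nat.factorial] at h
  have h2 := (abs_le.1 h).2
  have h3 : |y| ^ 3 ≤ c * y ^ 2 := by
    rw [pow_succ, sq_abs, mul_comm]
    exact mul_le_mul_of_nonneg_right hy (sq_nonneg _)
  nlinarith [sq_nonneg y, abs_nonneg y]

/-- Freedman's inequality for martingales with bounded increments. -/
lemma freedman {G : Filtration ℕ mΩ} {ξ v : ℕ → Ω → ℝ} {C : ℝ}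
    (hξ : ∀ n, Measurable[G (n + 1)] (ξ n)) (hξC : ∀ n ω, |ξ n ω| ≤ C)
    (hv : ∀ n, BddMeas (G n) (v n))
    (hmean : ∀ n, SameCondMean μ (G n) (ξ n) 0)
    (hvar : ∀ n, SameCondMean μ (G n) (fun ω => ξ n ω ^ 2) (v n))
    {a B : ℝ} (ha : 0 < a) (hB : 0 < B) (haB : a * C ≤ B) :
    μ {ω | ∃ n, a ≤ ∑ k ∈ Finset.range n, ξ k ω ∧ ∑ k ∈ Finset.range n, v k ω ≤ B} ≤
      ENNReal.ofReal (Real.exp (-(a ^ 2 / (2 * B) * (1 - a * C / B)))) := by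
  -- This exponent maximizes `l * a - l^2 * B / 2`. The factor `1 + l * C` in `κ` below is the
  -- Taylor error from `exp_le_quadratic`.
  set l : ℝ := a / B with hl
  have hl0 : 0 < l := div_pos ha hB
  set κ : ℝ := l ^ 2 * (1 + l * C) / 2 with hκ
  have hξb : ∀ n, BddMeas (G (n + 1)) (ξ n) := fun n => ⟨hξ n, C, hξC n⟩
  have hC0 : 0 ≤ C := nonneg_of_forall_abs_le μ (hξC 0)
  have hlC : l * C ≤ 1 := by
    rw [hl, div_mul_eq_mul_div, div_le_one hB]; exact haB
  have hκ0 : 0 ≤ κ := by positivity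
  let S : ℕ → Ω → ℝ := fun n ω => ∑ k ∈ Finset.range n, ξ k ω
  let V : ℕ → Ω → ℝ := fun n ω => ∑ k ∈ Finset.range n, v k ω
  have hS : ∀ n, BddMeas (G n) (S n) := fun n =>
    BddMeas.sum _ fun k hk => (hξb k).mono (G.mono (Finset.mem_range.1 hk))
  have hV : ∀ n, BddMeas (G n) (V n) := fun n =>
    BddMeas.sum _ fun k hk => (hv k).mono (G.mono (Finset.mem_range.1 hk).le)
  let M : ℕ → Ω → ℝ := fun n ω => Real.exp (l * S n ω - κ * V n ω)
  have hM : ∀ n, BddMeas (G n) (M n) := fun n =>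
    (((hS n).const_mul l).sub ((hV n).const_mul κ)).exp
  have hsuper : ∀ n Z, BddMeas (G n) Z → (∀ ω, 0 ≤ Z ω) →
      ∫ ω, Z ω * M (n + 1) ω ∂μ ≤ ∫ ω, Z ω * M n ω ∂μ := by
    intro n Z hZ hZ0
    -- The compensator of step `n` is already known at time `n`, so it can be put into the test
    -- function. It is later absorbed by `1 + x ≤ exp x`.
    let Y : Ω → ℝ := fun ω => Z ω * M n ω * Real.exp (-(κ * v n ω))
    have hY : BddMeas (G n) Y := (hZ.mul (hM n)).mul ((hv n).const_mul κ).neg.exp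
    have hY0 : ∀ ω, 0 ≤ Y ω := fun ω =>
      mul_nonneg (mul_nonneg (hZ0 ω) (Real.exp_nonneg _)) (Real.exp_nonneg _)
    have hY' := hY.mono (G.mono n.le_succ)
    have hYi := hY'.integrable (μ := μ) (G.le _)
    have hYξ := (hY'.mul (hξb n)).integrable (μ := μ) (G.le _)
    have hYξ2 := (hY'.mul (hξb n).sq).integrable (μ := μ) (G.le _)
    have hYv := (hY.mul (hv n)).integrable (μ := μ) (G.le _)
    calc ∫ ω, Z ω * M (n + 1) ω ∂μ
        ≤ ∫ ω, (Y ω + l * (Y ω * ξ n ω) + κ * (Y ω * ξ n ω ^ 2)) ∂μ := by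
          refine integral_mono
            (((hZ.mono (G.mono n.le_succ)).mul (hM (n + 1))).integrable (G.le _))
            ((hYi.add (hYξ.const_mul l)).add (hYξ2.const_mul κ)) fun ω => ?_
          have h1 : M (n + 1) ω = M n ω * Real.exp (-(κ * v n ω)) * Real.exp (l * ξ n ω) := by
            simp only [M, S, V, Finset.sum_range_succ, ← Real.exp_add]
            congr 1; ring
          have h2 : Real.exp (l * ξ n ω) ≤ 1 + l * ξ n ω + κ * ξ n ω ^ 2 := by
            have h3 : |l * ξ n ω| ≤ l * C := by
              rw [abs_mul, abs_of_pos hl0]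
              exact mul_le_mul_of_nonneg_left (hξC n ω) hl0.le
            refine (exp_le_quadratic h3 hlC).trans (le_of_eq ?_)
            rw [hκ]; ring
          calc Z ω * M (n + 1) ω = Y ω * Real.exp (l * ξ n ω) := by rw [h1]; simp only [Y]; ring
            _ ≤ Y ω * (1 + l * ξ n ω + κ * ξ n ω ^ 2) := mul_le_mul_of_nonneg_left h2 (hY0 ω)
            _ = _ := by ring
      _ = ∫ ω, Y ω ∂μ + κ * ∫ ω, Y ω * v n ω ∂μ := by
          rw [integral_add (f := fun ω => Y ω + l * (Y ω * ξ n ω)) (hYi.add (hYξ.const_mul l))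
              (hYξ2.const_mul κ),
            integral_add hYi (hYξ.const_mul l), integral_const_mul, integral_const_mul,
            hmean n Y hY, hvar n Y hY]
          simp
      _ = ∫ ω, (Y ω + κ * (Y ω * v n ω)) ∂μ := by
          rw [integral_add hYi (hYv.const_mul κ), integral_const_mul]
      _ ≤ ∫ ω, Z ω * M n ω ∂μ := by
          refine integral_mono (hYi.add (hYv.const_mul κ))
            ((hZ.mul (hM n)).integrable (G.le _)) fun ω => ?_
          have h1 : 1 + κ * v n ω ≤ Real.exp (κ * v n ω) := by
            linarith [Real.add_one_le_exp (κ * v n ω)]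
          calc Y ω + κ * (Y ω * v n ω) = Y ω * (1 + κ * v n ω) := by ring
            _ ≤ Y ω * Real.exp (κ * v n ω) := mul_le_mul_of_nonneg_left h1 (hY0 ω)
            _ = Z ω * M n ω := by
              simp only [Y]
              rw [mul_assoc, ← Real.exp_add]; simp
  have hville := measure_exists_ge_le (μ := μ) hM (fun n ω => Real.exp_nonneg _)
    (fun ω => by simp [M, S, V]) hsuper (Real.exp_pos (l * a - κ * B))
  have hexp : (Real.exp (l * a - κ * B))⁻¹ = Real.exp (-(a ^ 2 / (2 * B) * (1 - a * C / B))) := by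
    rw [← Real.exp_neg]
    congr 2
    rw [hκ, hl]
    field_simp
    ring
  rw [hexp] at hville
  refine (measure_mono ?_).trans hville
  rintro ω ⟨n, h1, h2⟩
  refine ⟨n, Real.exp_le_exp.2 ?_⟩
  have := mul_le_mul_of_nonneg_left h1 hl0.le
  have := mul_le_mul_of_nonneg_left h2 hκ0
  simp only [S, V]
  linarith

end CondMean

/-! ### The upper law of the iterated logarithm along geometric blocks -/

section IteratedLogarithm

lemma eventually_mul_le_mul_pow {θ : ℝ} (hθ : 1 < θ) (c : ℝ) {d : ℝ} (hd : 0 < d) :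
    ∀ᶠ k : ℕ in atTop, c * (k : ℝ) ≤ d * θ ^ k := by
  have h := (tendsto_pow_const_div_const_pow_of_one_lt 1 hθ).const_mul c
  rw [mul_zero] at h
  filter_upwards [h.eventually_lt_const hd] with k hk
  have hpos : 0 < θ ^ k := pow_pos (by linarith) k
  rw [pow_one, ← mul_div_assoc, div_lt_iff₀ hpos] at hk
  exact hk.le

variable {Ω : Type*} {mΩ : MeasurableSpace Ω} {μ : Measure Ω} [IsProbabilityMeasure μ]

/-- Upper half of the law of the iterated logarithm for a martingale with bounded increments,
observed at the multiples of `τ`. -/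
lemma lil_upper {G : Filtration ℕ mΩ} {ξ v : ℕ → Ω → ℝ} {C : ℝ}
    (hξ : ∀ n, Measurable[G (n + 1)] (ξ n)) (hξC : ∀ n ω, |ξ n ω| ≤ C)
    (hv : ∀ n, BddMeas (G n) (v n))
    (hmean : ∀ n, SameCondMean μ (G n) (ξ n) 0)
    (hvar : ∀ n, SameCondMean μ (G n) (fun ω => ξ n ω ^ 2) (v n))
    (τ : ℕ) {b : ℝ} (hb : 0 < b)
    (hV : ∀ᵐ ω ∂μ, ∀ᶠ t : ℕ in atTop, ∑ k ∈ Finset.range (t * τ), v k ω ≤ b * t)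
    {θ : ℝ} (hθ : 1 < θ) :
    ∀ᵐ ω ∂μ, ∀ᶠ t : ℕ in atTop,
      ∑ k ∈ Finset.range (t * τ), ξ k ω ≤ θ ^ 2 * √b * phi t := by
  have hθ0 : 0 < θ := by linarith
  have hlog : 0 < Real.log θ := Real.log_pos hθ
  -- Block `k` is `θ^k ≤ t < θ^(k+1)`: `B k` bounds the variance up to its end, and `L k` is `log
  -- log` of its beginning. The extra `θ` in `a k` gives the Freedman exponent `θ^2 * L k`; the
  -- correction factor costs at most one `θ`, leaving the summable bound `(k * log θ)^(-θ)`.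
  let B : ℕ → ℝ := fun k => b * θ ^ (k + 1)
  let L : ℕ → ℝ := fun k => Real.log (k * Real.log θ)
  let a : ℕ → ℝ := fun k => θ * √(2 * B k * L k)
  let E : ℕ → Set Ω := fun k =>
    {ω | ∃ n, a k ≤ ∑ i ∈ Finset.range n, ξ i ω ∧ ∑ i ∈ Finset.range n, v i ω ≤ B k}
  have hBpos : ∀ k, 0 < B k := fun k => by positivity
  have hC0 : 0 ≤ C := nonneg_of_forall_abs_le μ (hξC 0)
  have hLpos : ∀ᶠ k : ℕ in atTop, 1 ≤ L k := by
    have : Tendsto (fun k : ℕ => Real.log (k * Real.log θ)) atTop atTop :=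
      Real.tendsto_log_atTop.comp (tendsto_natCast_atTop_atTop.atTop_mul_const hlog)
    exact this.eventually_ge_atTop 1
  have hθ1 : 0 < 1 - 1 / θ := by
    rw [sub_pos, div_lt_one hθ0]; exact hθ
  have hbound : ∀ᶠ k in atTop, μ (E k) ≤ ENNReal.ofReal ((k * Real.log θ) ^ (-θ)) := by
    filter_upwards [hLpos, eventually_gt_atTop 0,
      eventually_mul_le_mul_pow hθ (2 * θ ^ 2 * C ^ 2 * Real.log θ)
        (d := (1 - 1 / θ) ^ 2 * (b * θ)) (by positivity)] with k hL hk hpow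
    have hk' : (0 : ℝ) < k := by exact_mod_cast hk
    have hapos : 0 < a k := by
      have := hBpos k
      have : 0 < L k := by linarith
      positivity
    have ha2 : a k ^ 2 = 2 * θ ^ 2 * B k * L k := by
      have := hBpos k
      simp only [a]
      rw [mul_pow, Real.sq_sqrt (by positivity)]
      ring
    have hLk : L k ≤ k * Real.log θ := by
      have := Real.log_le_sub_one_of_pos (mul_pos hk' hlog)
      simp only [L]; linarith
    -- After squaring, one factor `B k` cancels, and the linear bound on `L k` is beaten by the
    -- geometric growth of the other.
    have haC : a k * C ≤ (1 - 1 / θ) * B k := by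
      have hBk := hBpos k
      refine (pow_le_pow_iff_left₀ (by positivity) (by positivity) two_ne_zero).1 ?_
      rw [mul_pow, ha2, mul_pow]
      have h1 : 2 * θ ^ 2 * C ^ 2 * L k ≤ (1 - 1 / θ) ^ 2 * B k := by
        calc _ ≤ 2 * θ ^ 2 * C ^ 2 * (k * Real.log θ) :=
              mul_le_mul_of_nonneg_left hLk (by positivity)
          _ ≤ (1 - 1 / θ) ^ 2 * (b * θ) * θ ^ k := by linarith
          _ = _ := by simp only [B, pow_succ]; ring
      nlinarith
    have hfree := freedman hξ hξC hv hmean hvar hapos (hBpos k)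
      (haC.trans (by
        have : 1 - 1 / θ ≤ 1 := by
          have : 0 < 1 / θ := by positivity
          linarith
        nlinarith [hBpos k]))
    refine hfree.trans (ENNReal.ofReal_le_ofReal ?_)
    rw [Real.rpow_def_of_pos (mul_pos hk' hlog)]
    refine Real.exp_le_exp.2 ?_
    have h1 : a k ^ 2 / (2 * B k) = θ ^ 2 * L k := by
      rw [ha2]
      have := (hBpos k).ne'
      field_simp
    have h2 : 1 / θ ≤ 1 - a k * C / B k := by
      have := (div_le_iff₀ (hBpos k)).2 haC
      linarith
    rw [h1]
    have h3 : θ ^ 2 * L k * (1 / θ) ≤ θ ^ 2 * L k * (1 - a k * C / B k) :=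
      mul_le_mul_of_nonneg_left h2 (by positivity)
    have h4 : θ ^ 2 * L k * (1 / θ) = θ * L k := by field_simp
    have h5 : Real.log (k * Real.log θ) = L k := rfl
    rw [h5]
    linarith
  obtain ⟨K, hK⟩ := eventually_atTop.1 hbound
  have hsum : ∑' k, μ (E (k + K)) ≠ ⊤ := by
    have hs : Summable fun k : ℕ => ((k : ℝ) * Real.log θ) ^ (-θ) := by
      have h1 : Summable fun k : ℕ => (k : ℝ) ^ (-θ) := by
        rw [Real.summable_nat_rpow]; linarith
      refine (h1.mul_right (Real.log θ ^ (-θ))).congr fun k => ?_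
      rw [Real.mul_rpow (Nat.cast_nonneg k) hlog.le]
    have hs' := (summable_nat_add_iff K).2 hs
    refine ne_top_of_le_ne_top hs'.tsum_ofReal_ne_top (ENNReal.tsum_le_tsum fun k => ?_)
    exact hK (k + K) (Nat.le_add_left K k)
  filter_upwards [ae_eventually_notMem hsum, hV] with ω h1 h2
  obtain ⟨N, hN⟩ := eventually_atTop.1 (h1.and ((tendsto_add_atTop_iff_nat K).2 tendsto_id
    |>.eventually (hLpos.and (eventually_gt_atTop 0))))
  filter_upwards [h2, eventually_ge_atTop 1,
    (tendsto_natCast_atTop_atTop (R := ℝ)).eventually_ge_atTop (θ ^ (N + K))] with t h2 ht1 ht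
  obtain ⟨k, hk1, hk2⟩ := exists_nat_pow_near (x := (t : ℝ)) (by exact_mod_cast ht1) hθ
  have hkN : N + K ≤ k := Nat.lt_succ_iff.1 ((pow_lt_pow_iff_right₀ hθ).1 (ht.trans_lt hk2))
  have h3 := hN (k - K) (by omega)
  simp only [id, Nat.sub_add_cancel (show K ≤ k by omega)] at h3
  obtain ⟨hE, hL, hk0⟩ := h3
  have hk' : (0 : ℝ) < k := by exact_mod_cast hk0
  have hVB : ∑ i ∈ Finset.range (t * τ), v i ω ≤ B k :=
    h2.trans (mul_le_mul_of_nonneg_left hk2.le hb.le)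
  have hS : ∑ i ∈ Finset.range (t * τ), ξ i ω < a k := by
    by_contra h
    exact hE ⟨t * τ, not_lt.1 h, hVB⟩
  refine hS.le.trans ?_
  have hpow : 0 < θ ^ k := pow_pos hθ0 k
  have hLL : L k ≤ Real.log (Real.log t) := by
    simp only [L]
    rw [← Real.log_pow]
    refine Real.log_le_log ?_ (Real.log_le_log hpow hk1)
    rw [Real.log_pow]; positivity
  -- Passing from `θ^(k+1)` to `t` costs a single `θ`; it is enlarged to `θ^2` so that it leaves the
  -- square root as `θ`.
  have hle : 2 * B k * L k ≤ θ ^ 2 * (b * (2 * t * Real.log (Real.log t))) := by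
    calc 2 * B k * L k = 2 * b * θ * (θ ^ k * L k) := by simp only [B, pow_succ]; ring
      _ ≤ 2 * b * θ * (t * Real.log (Real.log t)) := by
          refine mul_le_mul_of_nonneg_left ?_ (by positivity)
          exact mul_le_mul hk1 hLL (by linarith) (by positivity)
      _ ≤ 2 * b * θ ^ 2 * (t * Real.log (Real.log t)) := by
          refine mul_le_mul_of_nonneg_right ?_ (mul_nonneg (by positivity) (by linarith))
          exact mul_le_mul_of_nonneg_left (by nlinarith) (by positivity)
      _ = _ := by ring
  calc a k ≤ θ * √(θ ^ 2 * (b * (2 * t * Real.log (Real.log t)))) :=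
        mul_le_mul_of_nonneg_left (Real.sqrt_le_sqrt hle) hθ0.le
    _ = θ ^ 2 * √b * phi t := by
        rw [Real.sqrt_mul (by positivity), Real.sqrt_sq hθ0.le, Real.sqrt_mul hb.le, phi]
        ring

end IteratedLogarithm

/-! ### Idle time computed from geometric variables -/

section Geometric

lemma integrable_of_discrete_of_abs_le {α : Type*} [MeasurableSpace α]
    [DiscreteMeasurableSpace α] {ν : Measure α} [IsFiniteMeasure ν] {f : α → ℝ} {C : ℝ}
    (hf : ∀ x, |f x| ≤ C) : Integrable f ν :=
  Integrable.of_bound Measurable.of_discrete.aestronglyMeasurable C (Eventually.of_forall hf)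

/-- Memorylessness: condition on the first attempt. After a failure the number of remaining failures
has the original law. -/
lemma integral_geometricMeasure_succ {p : unitInterval} (hp : 0 < p) {f : ℕ → ℝ} {C : ℝ}
    (hf : ∀ n, |f n| ≤ C) :
    ∫ n, f n ∂geometricMeasure p =
      p * f 0 + (1 - p) * ∫ n, f (n + 1) ∂geometricMeasure p := by
  have h1 := hasSum_integral_geometricMeasure hp.ne' (integrable_of_discrete_of_abs_le hf)
  have h2 := hasSum_integral_geometricMeasure hp.ne'
    (integrable_of_discrete_of_abs_le (f := fun n => f (n + 1)) fun n => hf _)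
  refine h1.unique ((hasSum_nat_add_iff' 1).1 ?_)
  simp only [Finset.sum_range_one, smul_eq_mul, pow_zero, one_mul, add_sub_cancel_left]
  refine (h2.mul_left (1 - (p : ℝ))).congr_fun fun n => ?_
  simp only [smul_eq_mul]
  ring

variable {p : Fin 2 → unitInterval}

lemma integral_pi_fin_two {F : (Fin 2 → ℕ) → ℝ} {C : ℝ} (hF : ∀ n, |F n| ≤ C) :
    ∫ n, F n ∂(Measure.pi fun i => geometricMeasure (p i)) =
      ∫ x, ∫ y, F ![x, y] ∂geometricMeasure (p 1) ∂geometricMeasure (p 0) := by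
  have h := (measurePreserving_piFinTwo fun i => geometricMeasure (p i)).symm
  rw [← h.integral_comp', integral_prod _ (integrable_of_discrete_of_abs_le fun x => hF _)]
  congr! with x y

lemma integral_pi_geometric_update (hp : ∀ j, 0 < p j) {F : (Fin 2 → ℕ) → ℝ} {C : ℝ}
    (hF : ∀ n, |F n| ≤ C) (j : Fin 2) :
    ∫ n, F n ∂(Measure.pi fun i => geometricMeasure (p i)) =
      p j * ∫ n, F (Function.update n j 0) ∂(Measure.pi fun i => geometricMeasure (p i)) +
      (1 - p j) *
        ∫ n, F (Function.update n j (n j + 1)) ∂(Measure.pi fun i => geometricMeasure (p i)) := by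
  have hC : 0 ≤ C := (abs_nonneg _).trans (hF 0)
  have hb : ∀ (i : Fin 2) (f : ℕ → ℝ), (∀ n, |f n| ≤ C) →
      |∫ n, f n ∂geometricMeasure (p i)| ≤ C := by
    intro i f hf
    have := norm_integral_le_of_norm_le_const (μ := geometricMeasure (p i)) (f := f) (C := C)
      (Eventually.of_forall hf)
    simpa using this
  rw [integral_pi_fin_two hF, integral_pi_fin_two fun n => hF _, integral_pi_fin_two fun n => hF _]
  have e0 : ∀ x y z : ℕ, Function.update ![x, y] 0 z = ![z, y] := fun x y z => by
    ext i; fin_cases i <;> rfl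
  have e1 : ∀ x y z : ℕ, Function.update ![x, y] 1 z = ![x, z] := fun x y z => by
    ext i; fin_cases i <;> rfl
  fin_cases j
  · rw [integral_geometricMeasure_succ (hp 0) fun n => hb 1 _ fun y => hF _]
    simp only [Fin.zero_eta, Fin.isValue, e0, integral_const, probReal_univ, smul_eq_mul, one_mul,
      Matrix.cons_val_zero]
  · have : ∀ x, ∫ y, F ![x, y] ∂geometricMeasure (p 1) = p 1 * F ![x, 0] +
        (1 - p 1) * ∫ y, F ![x, y + 1] ∂geometricMeasure (p 1) := fun x =>
      integral_geometricMeasure_succ (hp 1) fun n => hF _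
    simp_rw [this]
    rw [integral_add ((integrable_of_discrete_of_abs_le fun x => hF _).const_mul _)
      ((integrable_of_discrete_of_abs_le fun x => hb 1 _ fun y => hF _).const_mul _),
      integral_const_mul, integral_const_mul]
    simp only [Fin.mk_one, Fin.isValue, e1, integral_const, probReal_univ, smul_eq_mul, one_mul,
      Matrix.cons_val_one, Matrix.cons_val_fin_one]

/-- The mean of `G` of the number of idle slots among `r` slots in which the packets of the
clients in `S` are transmitted until they are delivered. -/
noncomputable def idleMean (p : Fin 2 → unitInterval) (G : ℕ → ℝ) (S : Finset (Fin 2)) (r : ℕ) :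
    ℝ :=
  ∫ n : Fin 2 → ℕ, G (r - ∑ i ∈ S, (n i + 1)) ∂(Measure.pi fun i => geometricMeasure (p i))

lemma idleMean_empty (G : ℕ → ℝ) (r : ℕ) : idleMean p G ∅ r = G r := by
  simp [idleMean]

lemma idleMean_zero (G : ℕ → ℝ) (S : Finset (Fin 2)) : idleMean p G S 0 = G 0 := by
  simp [idleMean]

lemma exists_abs_le_tsub (G : ℕ → ℝ) (r : ℕ) : ∃ C, ∀ n, |G (r - n)| ≤ C := by
  refine ⟨∑ i ∈ Finset.range (r + 1), |G i|, fun n => ?_⟩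
  exact Finset.single_le_sum (f := fun i => |G i|) (fun i _ => abs_nonneg _)
    (Finset.mem_range.2 (by omega))

/-- The slot is spent on `j`, which either leaves the set or starts afresh. Any `j ∈ S` may be
chosen because the sum does not depend on the service order; this is why the law of the idle time
does not depend on who has priority. -/
lemma idleMean_succ (hp : ∀ j, 0 < p j) (G : ℕ → ℝ) {S : Finset (Fin 2)} {j : Fin 2} (hj : j ∈ S)
    (r : ℕ) :
    idleMean p G S (r + 1) = p j * idleMean p G (S.erase j) r + (1 - p j) * idleMean p G S r := by
  obtain ⟨C, hC⟩ := exists_abs_le_tsub G (r + 1)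
  rw [idleMean, integral_pi_geometric_update hp (fun n => hC _) j, idleMean, idleMean]
  have e : ∀ (n : Fin 2 → ℕ) (x : ℕ), ∑ i ∈ S, (Function.update n j x i + 1) =
      ∑ i ∈ S.erase j, (n i + 1) + (x + 1) := by
    intro n x
    rw [← Finset.sum_erase_add _ _ hj]
    congr 1
    · refine Finset.sum_congr rfl fun i hi => ?_
      rw [Function.update_of_ne (Finset.ne_of_mem_erase hi)]
    · simp
  congr 3
  · ext n
    rw [e]; congr 1; omega
  · ext n
    rw [e, ← Finset.sum_erase_add S _ hj]; congr 1; omega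

lemma idleMean_cast {τ : ℕ} (hτ : 0 < τ) (S : Finset (Fin 2)) :
    idleMean p (fun n => (n : ℝ)) S τ = τ * idleProportion τ p S := by
  rw [idleProportion, ← mul_assoc, mul_one_div_cancel (by positivity), one_mul, idleMean]
  congr with n
  rcases le_total (∑ i ∈ S, (n i + 1)) τ with h | h
  · rw [Nat.cast_sub h, max_eq_left]
    · push_cast; rfl
    · rw [sub_nonneg]; exact_mod_cast h
  · rw [Nat.sub_eq_zero_of_le h, max_eq_right]
    · simp
    · rw [sub_nonpos]; exact_mod_cast h

end Geometric

/-! ### Rules for weak conditional means -/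

section CondMeanCalculus

variable {Ω : Type*} {m m' mΩ : MeasurableSpace Ω} {μ : Measure Ω}
  {f f' g g' h : Ω → ℝ}

lemma SameCondMean.refl (f : Ω → ℝ) : SameCondMean μ m f f := fun _ _ => rfl

lemma SameCondMean.trans (h1 : SameCondMean μ m f g) (h2 : SameCondMean μ m g h) :
    SameCondMean μ m f h := fun Z hZ => (h1 Z hZ).trans (h2 Z hZ)

lemma SameCondMean.mono (hm : m ≤ m') (h1 : SameCondMean μ m' f g) : SameCondMean μ m f g :=
  fun Z hZ => h1 Z (hZ.mono hm)

lemma SameCondMean.mul_left (h1 : SameCondMean μ m f g) {Y : Ω → ℝ} (hY : BddMeas m Y) :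
    SameCondMean μ m (fun ω => Y ω * f ω) (fun ω => Y ω * g ω) := fun Z hZ => by
  simpa only [mul_assoc] using h1 _ (hZ.mul hY)

lemma SameCondMean.add [IsProbabilityMeasure μ] (hm : m ≤ mΩ)
    (hf : BddMeas mΩ f) (hg : BddMeas mΩ g)
    (hf' : BddMeas mΩ f') (hg' : BddMeas mΩ g')
    (h1 : SameCondMean μ m f g) (h2 : SameCondMean μ m f' g') :
    SameCondMean μ m (fun ω => f ω + f' ω) (fun ω => g ω + g' ω) := fun Z hZ => by
  have hZ' := hZ.mono hm
  simp only [mul_add]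
  rw [integral_add ((hZ'.mul hf).integrable le_rfl) ((hZ'.mul hf').integrable le_rfl),
    integral_add ((hZ'.mul hg).integrable le_rfl) ((hZ'.mul hg').integrable le_rfl),
    h1 Z hZ, h2 Z hZ]

lemma SameCondMean.sum [IsProbabilityMeasure μ] (hm : m ≤ mΩ) {ι : Type*} (s : Finset ι)
    {F H : ι → Ω → ℝ}
    (hF : ∀ i ∈ s, BddMeas mΩ (F i)) (hH : ∀ i ∈ s, BddMeas mΩ (H i))
    (hFH : ∀ i ∈ s, SameCondMean μ m (F i) (H i)) :
    SameCondMean μ m (fun ω => ∑ i ∈ s, F i ω) (fun ω => ∑ i ∈ s, H i ω) := fun Z hZ => by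
  have hZ' := hZ.mono hm
  simp only [Finset.mul_sum]
  rw [integral_finsetSum _ fun i hi => (hZ'.mul (hF i hi)).integrable le_rfl,
    integral_finsetSum _ fun i hi => (hZ'.mul (hH i hi)).integrable le_rfl]
  exact Finset.sum_congr rfl fun i hi => hFH i hi Z hZ

lemma SameCondMean.congr (h1 : SameCondMean μ m f g) (hf : ∀ ω, f' ω = f ω)
    (hg : ∀ ω, g' ω = g ω) : SameCondMean μ m f' g' := by
  rwa [funext hf, funext hg]

end CondMeanCalculus

/-! ### Deterministic evolution within a frame -/

section Pending

lemma target_eq_none_iff {f : Fin 2} {A : Finset (Fin 2)} : target f A = none ↔ A = ∅ := by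
  revert f A; decide

lemma mem_of_target_eq_some {f j : Fin 2} {A : Finset (Fin 2)} (h : target f A = some j) :
    j ∈ A := by
  revert f A j; decide

lemma pending_succ_subset (f : Fin 2) (x : ℕ → Bool) (s : ℕ) :
    pending f x (s + 1) ⊆ pending f x s := by
  rw [pending]
  split
  · exact subset_rfl
  · split_ifs
    · exact Finset.erase_subset _ _
    · exact subset_rfl

lemma pending_antitone (f : Fin 2) (x : ℕ → Bool) : Antitone (pending f x) :=
  antitone_nat_of_succ_le (pending_succ_subset f x)

/-- A client's packet is delivered iff one of its transmissions succeeds. -/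
lemma sum_success_eq (f : Fin 2) (x : ℕ → Bool) (j : Fin 2) (s : ℕ) :
    ∑ r ∈ Finset.range s, (if target f (pending f x r) = some j ∧ x r = true then (1 : ℝ) else 0) =
      if j ∉ pending f x s then 1 else 0 := by
  induction s with
  | zero => simp [pending]
  | succ s ih =>
    rw [Finset.sum_range_succ, ih, pending]
    cases h : target f (pending f x s) with
    | none => simp
    | some i =>
      cases hx : x s
      · simp
      · by_cases hij : i = j
        · subst hij
          simp [mem_of_target_eq_some h]
        · simp [hij, Ne.symm hij]

end Pending

/-! ### The Markov chain of undelivered packets -/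

section Frames

variable {Ω : Type*} {mΩ : MeasurableSpace Ω} {μ : Measure Ω}
  {ℱ : Filtration ℕ mΩ} {τ : ℕ} {p : Fin 2 → unitInterval} {q : Fin 2 → ℝ}
  {first : ℕ → Ω → Fin 2} {success : ℕ → Ω → Bool}

lemma IsMWDF.measurable_pendingAt (hsys : IsMWDF τ first success μ ℱ p q) (k s : ℕ) :
    Measurable[ℱ (k * τ + s)] (pendingAt τ first success k s) := by
  induction s with
  | zero => exact measurable_const
  | succ s ih =>
    have h1 := (hsys.measurable_first k).mono (ℱ.mono (by omega : k * τ ≤ k * τ + (s + 1))) le_rfl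
    have h2 := ih.mono (ℱ.mono (by omega : k * τ + s ≤ k * τ + (s + 1))) le_rfl
    have h3 := hsys.measurable_success (k * τ + s)
    exact (Measurable.of_discrete (f := fun y : Fin 2 × Finset (Fin 2) × Bool =>
      match target y.1 y.2.1 with
      | none => y.2.1
      | some j => if y.2.2 then y.2.1.erase j else y.2.1)).comp (h1.prodMk (h2.prodMk h3))

/-- Functions of the state of a frame are known at the time of that state. -/
lemma IsMWDF.bddMeas_state (hsys : IsMWDF τ first success μ ℱ p q) (k s : ℕ)
    (h : Fin 2 → Finset (Fin 2) → ℝ) :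
    BddMeas (ℱ (k * τ + s)) (fun ω => h (first k ω) (pendingAt τ first success k s ω)) := by
  have h1 := (hsys.measurable_first k).mono (ℱ.mono (by omega : k * τ ≤ k * τ + s)) le_rfl
  exact BddMeas.of_finite (h1.prodMk (hsys.measurable_pendingAt k s))
    (fun y : Fin 2 × Finset (Fin 2) => h y.1 y.2)

lemma IsMWDF.bddMeas_first (hsys : IsMWDF τ first success μ ℱ p q) (k : ℕ) (h : Fin 2 → ℝ) :
    BddMeas (ℱ (k * τ)) (fun ω => h (first k ω)) :=
  BddMeas.of_finite (hsys.measurable_first k) h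

/-- Whether the transmission in slot `s` of frame `k` is to client `j`. -/
noncomputable def attempt (τ : ℕ) (first : ℕ → Ω → Fin 2) (success : ℕ → Ω → Bool) (j : Fin 2)
    (k s : ℕ) (ω : Ω) : ℝ :=
  if served τ first success k s ω = some j then 1 else 0

/-- Whether slot `s` of frame `k` delivers the packet of client `j`. -/
noncomputable def delivery (τ : ℕ) (first : ℕ → Ω → Fin 2) (success : ℕ → Ω → Bool) (j : Fin 2)
    (k s : ℕ) (ω : Ω) : ℝ :=
  if served τ first success k s ω = some j ∧ success (k * τ + s) ω = true then 1 else 0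

lemma IsMWDF.bddMeas_attempt (hsys : IsMWDF τ first success μ ℱ p q) (j : Fin 2) (k s : ℕ) :
    BddMeas (ℱ (k * τ + s)) (attempt τ first success j k s) :=
  hsys.bddMeas_state k s fun f A => if target f A = some j then 1 else 0

lemma IsMWDF.bddMeas_delivery (hsys : IsMWDF τ first success μ ℱ p q) (j : Fin 2) (k s : ℕ) :
    BddMeas (ℱ (k * τ + s + 1)) (delivery τ first success j k s) := by
  have h1 := (hsys.bddMeas_attempt j k s).mono (ℱ.mono (by omega : _ ≤ k * τ + s + 1))
  have h2 : BddMeas (ℱ (k * τ + s + 1))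
      (fun ω => if success (k * τ + s) ω = true then (1 : ℝ) else 0) :=
    BddMeas.of_finite (hsys.measurable_success _) fun b => if b = true then (1 : ℝ) else 0
  convert h1.mul h2 using 2 with ω
  simp only [delivery, attempt]
  split_ifs <;> simp_all

lemma IsMWDF.sameCondMean_delivery [IsProbabilityMeasure μ]
    (hsys : IsMWDF τ first success μ ℱ p q) (j : Fin 2) (k : ℕ)
    {s : ℕ} (hs : s < τ) :
    SameCondMean μ (ℱ (k * τ + s)) (delivery τ first success j k s)
      (fun ω => p j * attempt τ first success j k s ω) := by
  refine sameCondMean_of_condExp (ℱ.le _)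
    ((hsys.bddMeas_delivery j k s).integrable (ℱ.le _)) ?_
  refine (hsys.channel k s hs j).trans (Eventually.of_forall fun ω => ?_)
  simp [attempt]

/-- The mean of `h` after one slot started with the clients in `A` undelivered. -/
noncomputable def stepMean (p : Fin 2 → unitInterval) (h : Fin 2 → Finset (Fin 2) → ℝ)
    (f : Fin 2) (A : Finset (Fin 2)) : ℝ :=
  match target f A with
  | none => h f A
  | some j => p j * h f (A.erase j) + (1 - p j) * h f A

/-- The state of a frame is a Markov chain. -/
lemma IsMWDF.sameCondMean_step [IsProbabilityMeasure μ]
    (hsys : IsMWDF τ first success μ ℱ p q) (k : ℕ) {s : ℕ} (hs : s < τ)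
    (h : Fin 2 → Finset (Fin 2) → ℝ) :
    SameCondMean μ (ℱ (k * τ + s))
      (fun ω => h (first k ω) (pendingAt τ first success k (s + 1) ω))
      (fun ω => stepMean p h (first k ω) (pendingAt τ first success k s ω)) := by
  -- The new value of `h` is the old one plus the sum over `j` of `d j` times the delivery
  -- indicator. Since `d j` is known before the slot, only the conditional mean of the deliveries is
  -- needed.
  let d : Fin 2 → Ω → ℝ := fun j ω =>
    h (first k ω) ((pendingAt τ first success k s ω).erase j) -
      h (first k ω) (pendingAt τ first success k s ω)
  have hd : ∀ j, BddMeas (ℱ (k * τ + s)) (d j) := fun j =>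
    hsys.bddMeas_state k s fun f A => h f (A.erase j) - h f A
  have hh := hsys.bddMeas_state k s h
  have hdel := fun j => (hsys.bddMeas_delivery j k s).mono (ℱ.le _)
  have hatt := fun j => (hsys.bddMeas_attempt j k s).mono (ℱ.le _)
  have hd' := fun j => (hd j).mono (ℱ.le _)
  have key := (SameCondMean.refl (μ := μ) (m := ℱ (k * τ + s)) _).add (ℱ.le _)
    (hh.mono (ℱ.le _)) (hh.mono (ℱ.le _))
    (BddMeas.sum Finset.univ fun j _ => (hd' j).mul (hdel j))
    (BddMeas.sum Finset.univ fun j _ => (hd' j).mul ((hatt j).const_mul (p j)))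
    (SameCondMean.sum (ℱ.le _) Finset.univ
      (fun j _ => (hd' j).mul (hdel j)) (fun j _ => (hd' j).mul ((hatt j).const_mul (p j)))
      fun j _ => (hsys.sameCondMean_delivery j k hs).mul_left (hd j))
  refine key.congr (fun ω => ?_) (fun ω => ?_)
  · have e : pendingAt τ first success k (s + 1) ω =
        match served τ first success k s ω with
        | none => pendingAt τ first success k s ω
        | some j => if success (k * τ + s) ω then (pendingAt τ first success k s ω).erase j
          else pendingAt τ first success k s ω := rfl
    rw [e]
    simp only [d, delivery]
    cases served τ first success k s ω with
    | none => simp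
    | some j =>
      cases success (k * τ + s) ω
      · simp
      · fin_cases j <;> simp
  · have e : served τ first success k s ω =
      target (first k ω) (pendingAt τ first success k s ω) := rfl
    simp only [d, attempt, e, stepMean]
    cases target (first k ω) (pendingAt τ first success k s ω) with
    | none => simp
    | some j => fin_cases j <;> simp <;> ring

lemma IsMWDF.bddMeas_count (hsys : IsMWDF τ first success μ ℱ p q) (k : ℕ)
    (T : Fin 2 → Finset (Fin 2)) (G : ℕ → ℝ) (r s : ℕ) :
    BddMeas mΩ (fun ω => G (∑ i ∈ Finset.range r,
      if pendingAt τ first success k (s + i) ω ∩ T (first k ω) = ∅ then 1 else 0)) := by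
  refine ⟨(Measurable.of_discrete (f := G)).comp (Finset.measurable_sum _ fun i _ => ?_), ?_⟩
  · have h1 := (hsys.measurable_first k).mono (ℱ.le _) le_rfl
    have h2 := (hsys.measurable_pendingAt k (s + i)).mono (ℱ.le _) le_rfl
    exact (Measurable.of_discrete (f := fun y : Fin 2 × Finset (Fin 2) =>
      if y.2 ∩ T y.1 = ∅ then 1 else 0)).comp (h1.prodMk h2)
  · obtain ⟨C, hC⟩ := exists_abs_le_tsub G r
    refine ⟨C, fun ω => ?_⟩
    have hle : (∑ i ∈ Finset.range r, if pendingAt τ first success k (s + i) ω ∩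
        T (first k ω) = ∅ then 1 else 0) ≤ r := by
      refine (Finset.sum_le_card_nsmul _ _ 1 fun i _ => ?_).trans (by simp)
      split_ifs <;> simp
    have := hC (r - ∑ i ∈ Finset.range r, if pendingAt τ first success k (s + i) ω ∩
        T (first k ω) = ∅ then 1 else 0)
    rwa [Nat.sub_sub_self hle] at this

/-- Backward induction on the remaining slots. By `hT`, a slot goes to a client of `T f` as long as
one is pending, so the one-step mean of the chain is exactly the recursion `idleMean_succ`. It is
applied with `T f` equal to both clients (idle slots) and to `{f}` (slots not given to `f`). -/
lemma IsMWDF.sameCondMean_count_of_add [IsProbabilityMeasure μ]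
    (hsys : IsMWDF τ first success μ ℱ p q) (hp : ∀ j, 0 < p j) (k : ℕ) {T : Fin 2 → Finset (Fin 2)}
    (hT : ∀ f A, A ∩ T f ≠ ∅ → ∃ j ∈ A ∩ T f, target f A = some j) (G : ℕ → ℝ) (r : ℕ) :
    ∀ s, s + r = τ → SameCondMean μ (ℱ (k * τ + s))
      (fun ω => G (∑ i ∈ Finset.range r,
        if pendingAt τ first success k (s + i) ω ∩ T (first k ω) = ∅ then 1 else 0))
      (fun ω => idleMean p G (pendingAt τ first success k s ω ∩ T (first k ω)) r) := by
  induction r with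
  | zero => intro s _; simpa [idleMean_zero] using SameCondMean.refl _
  | succ r ih =>
    intro s hs
    have h1 := (ih (s + 1) (by omega)).mono (ℱ.mono (by omega : k * τ + s ≤ k * τ + (s + 1)))
    have h2 := hsys.sameCondMean_step k (by omega : s < τ)
      (fun f A => idleMean p G (A ∩ T f) r)
    -- These indicators split off the absorbed case: once no client of `T f` is pending, none will
    -- be, and the count is `r + 1` surely. Otherwise the current slot contributes 0 to the count.
    have hE : ∀ c d : ℝ, BddMeas (ℱ (k * τ + s)) (fun ω =>
        if pendingAt τ first success k s ω ∩ T (first k ω) = ∅ then c else d) := fun c d =>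
      hsys.bddMeas_state k s fun f A => if A ∩ T f = ∅ then c else d
    have h3 := (h1.trans h2).mul_left (hE 0 1)
    have hb1 := hsys.bddMeas_count k T G r (s + 1)
    have h4 := (SameCondMean.refl (μ := μ) (m := ℱ (k * τ + s)) _).add (ℱ.le _)
      ((hE (G (r + 1)) 0).mono (ℱ.le _)) ((hE (G (r + 1)) 0).mono (ℱ.le _))
      (((hE 0 1).mono (ℱ.le _)).mul hb1)
      (((hE 0 1).mul (hsys.bddMeas_state k s (stepMean p _))).mono (ℱ.le _)) h3
    refine h4.congr (fun ω => ?_) (fun ω => ?_)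
    · by_cases h : pendingAt τ first success k s ω ∩ T (first k ω) = ∅
      · have h' : ∀ i, pendingAt τ first success k (s + i) ω ∩ T (first k ω) = ∅ := fun i =>
          Finset.subset_empty.1 ((Finset.inter_subset_inter_right
            (pending_antitone _ _ (Nat.le_add_right s i))).trans h.subset)
        simp [h, h']
      · rw [Finset.sum_range_succ']
        simp only [h, if_false, zero_add, one_mul, add_zero]
        refine congrArg G (Finset.sum_congr rfl fun i _ => ?_)
        rw [show s + (i + 1) = s + 1 + i by omega]
    · by_cases h : pendingAt τ first success k s ω ∩ T (first k ω) = ∅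
      · simp [h, idleMean_empty]
      · obtain ⟨j, hj, ht⟩ := hT _ _ h
        simp only [h, if_false, zero_add, one_mul, stepMean, ht]
        rw [idleMean_succ hp G hj, Finset.erase_inter]

/-- The conditional distribution, at the start of a frame, of the number of slots of the frame in
which no client of `T f` is pending, where `f` has priority. -/
lemma IsMWDF.sameCondMean_count [IsProbabilityMeasure μ]
    (hsys : IsMWDF τ first success μ ℱ p q) (hp : ∀ j, 0 < p j) (k : ℕ)
    {T : Fin 2 → Finset (Fin 2)}
    (hT : ∀ f A, A ∩ T f ≠ ∅ → ∃ j ∈ A ∩ T f, target f A = some j) (G : ℕ → ℝ) :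
    SameCondMean μ (ℱ (k * τ))
      (fun ω => G (∑ i ∈ Finset.range τ,
        if pendingAt τ first success k (0 + i) ω ∩ T (first k ω) = ∅ then 1 else 0))
      (fun ω => idleMean p G (T (first k ω)) τ) := by
  refine (hsys.sameCondMean_count_of_add hp k hT G τ 0 (zero_add τ)).congr (fun _ => rfl)
    fun ω => ?_
  have : pendingAt τ first success k 0 ω = Finset.univ := rfl
  rw [this, Finset.univ_inter]

end Frames

/-! ### Logarithmic bound from negative drift -/

section Drift

variable {Ω : Type*} {mΩ : MeasurableSpace Ω} {μ : Measure Ω} [IsProbabilityMeasure μ]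

/-- A process with bounded increments that drifts towards `0` is almost surely `O(log n)`. -/
lemma eventually_abs_le_log_of_drift {G : Filtration ℕ mΩ} {D σ g : ℕ → Ω → ℝ} {C δ : ℝ}
    (hD : ∀ n, BddMeas (G n) (D n)) (hD0 : ∀ ω, D 0 ω = 0)
    (hC : ∀ n ω, |D (n + 1) ω - D n ω| ≤ C)
    (hσ : ∀ n, BddMeas (G n) (σ n)) (hσ1 : ∀ n ω, σ n ω = 1 ∨ σ n ω = -1)
    (hσD : ∀ n ω, 0 ≤ σ n ω * D n ω)
    (hg : ∀ n, BddMeas (G n) (g n)) (hδ : 0 < δ) (hgδ : ∀ n ω, g n ω ≤ -δ)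
    (hdrift : ∀ n, SameCondMean μ (G n) (fun ω => σ n ω * (D (n + 1) ω - D n ω)) (g n)) :
    ∃ K : ℝ, ∀ᵐ ω ∂μ, ∀ᶠ n : ℕ in atTop, |D n ω| ≤ K * Real.log n := by
  have hC0 : 0 ≤ C := nonneg_of_forall_abs_le μ (hC 0)
  -- The conditions on `η` serve, in order, to allow the quadratic bound for the exponential, to
  -- keep the second-order term below half the drift, and to keep the contraction factor `1 - x`
  -- nonnegative.
  obtain ⟨η, hη, hη1, hη2, hη3⟩ : ∃ η : ℝ, 0 < η ∧ η * C ≤ 1 ∧ η * C ^ 2 ≤ δ / 2 ∧ η * δ ≤ 1 := by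
    refine ⟨min (1 / (C + 1)) (min (δ / 2 / (C ^ 2 + 1)) (1 / δ)), by positivity, ?_, ?_, ?_⟩
    · refine (mul_le_mul_of_nonneg_right (min_le_left _ _) hC0).trans ?_
      rw [div_mul_eq_mul_div, div_le_one (by positivity)]; linarith
    · refine (mul_le_mul_of_nonneg_right ((min_le_right _ _).trans (min_le_left _ _))
        (sq_nonneg C)).trans ?_
      rw [div_mul_eq_mul_div, div_le_iff₀ (by positivity)]; nlinarith
    · refine (mul_le_mul_of_nonneg_right ((min_le_right _ _).trans (min_le_right _ _))
        hδ.le).trans ?_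
      rw [div_mul_cancel₀ _ hδ.ne']
  set x : ℝ := η * δ / 2 with hx
  have hx0 : 0 < x := by positivity
  -- The recursion `m ↦ (1 - x) * m + exp (η * C)` maps values at most `K` to values at most `K`,
  -- and the initial moment is 1.
  set K : ℝ := 1 + Real.exp (η * C) / x with hK
  have hE : ∀ n, BddMeas (G n) (fun ω => Real.exp (η * |D n ω|)) := fun n =>
    ((hD n).abs.const_mul η).exp
  have hmom : ∀ n, ∫ ω, Real.exp (η * |D n ω|) ∂μ ≤ K := by
    intro n
    induction n with
    | zero =>
      simp only [hD0, abs_zero, mul_zero, Real.exp_zero, integral_const, probReal_univ,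
        smul_eq_mul, mul_one, hK]
      have : 0 < Real.exp (η * C) / x := by positivity
      linarith
    | succ n ih =>
      set E : Ω → ℝ := fun ω => Real.exp (η * |D n ω|)
      have hEn : BddMeas (G n) E := hE n
      have hE' := (hE n).mono (G.mono n.le_succ)
      have hΔ : BddMeas (G (n + 1)) (fun ω => σ n ω * (D (n + 1) ω - D n ω)) :=
        ((hσ n).mono (G.mono n.le_succ)).mul ((hD (n + 1)).sub ((hD n).mono (G.mono n.le_succ)))
      have hI1 := hE'.integrable (μ := μ) (G.le _)
      have hI2 := (hE'.mul hΔ).integrable (μ := μ) (G.le _)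
      have hI3 := ((hE n).mul (hg n)).integrable (μ := μ) (G.le _)
      calc ∫ ω, Real.exp (η * |D (n + 1) ω|) ∂μ
          ≤ ∫ ω, ((1 + (η * C) ^ 2) * E ω + η * (E ω * (σ n ω * (D (n + 1) ω - D n ω))) +
              Real.exp (η * C)) ∂μ := by
            refine integral_mono ((hE (n + 1)).integrable (G.le _))
              (((hI1.const_mul _).add (hI2.const_mul η)).add (integrable_const _)) fun ω => ?_
            have hs : |σ n ω * (D (n + 1) ω - D n ω)| ≤ C := by
              rw [abs_mul]
              rcases hσ1 n ω with h | h <;> simpa [h] using hC n ω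
            have habs : |D n ω| = σ n ω * D n ω := by
              have := hσD n ω
              rcases hσ1 n ω with h | h <;> rw [h] at this ⊢
              · rw [one_mul] at this ⊢; exact abs_of_nonneg this
              · rw [neg_one_mul] at this ⊢; exact abs_of_nonpos (by linarith)
            have hquad : Real.exp (η * (σ n ω * (D (n + 1) ω - D n ω))) ≤
                1 + η * (σ n ω * (D (n + 1) ω - D n ω)) + (η * C) ^ 2 := by
              have h1 : |η * (σ n ω * (D (n + 1) ω - D n ω))| ≤ η * C := by
                rw [abs_mul, abs_of_pos hη]
                exact mul_le_mul_of_nonneg_left hs hη.le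
              have h2 := (abs_le.1 (Real.abs_exp_sub_one_sub_id_le (h1.trans hη1))).2
              have h3 := sq_le_sq' (abs_le.1 h1).1 (abs_le.1 h1).2
              linarith
            -- Either the step stays on the same side of 0, or it crosses 0 and cannot land farther
            -- away than its own length.
            have hcase : |D (n + 1) ω| ≤ |D n ω| + σ n ω * (D (n + 1) ω - D n ω) ∨
                |D (n + 1) ω| ≤ C := by
              have h1 := abs_le.1 hs
              have h2 := hσD n ω
              have h3 : |D (n + 1) ω| = |σ n ω * D (n + 1) ω| := by
                rw [abs_mul]
                rcases hσ1 n ω with h | h <;> simp [h]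
              rw [h3, habs]
              rcases le_total 0 (σ n ω * D (n + 1) ω) with h | h
              · left; rw [abs_of_nonneg h]; linarith
              · right; rw [abs_of_nonpos h]; linarith
            have hE0 : 0 < E ω := Real.exp_pos _
            have hpos : 0 ≤ E ω * Real.exp (η * (σ n ω * (D (n + 1) ω - D n ω))) := by positivity
            have hmain : Real.exp (η * |D (n + 1) ω|) ≤
                E ω * Real.exp (η * (σ n ω * (D (n + 1) ω - D n ω))) + Real.exp (η * C) := by
              rcases hcase with h | h
              · have : Real.exp (η * |D (n + 1) ω|) ≤
                    E ω * Real.exp (η * (σ n ω * (D (n + 1) ω - D n ω))) := by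
                  simp only [E]
                  rw [← Real.exp_add, ← mul_add]
                  exact Real.exp_le_exp.2 (mul_le_mul_of_nonneg_left h hη.le)
                linarith [Real.exp_pos (η * C)]
              · have := Real.exp_le_exp.2 (mul_le_mul_of_nonneg_left h hη.le)
                linarith
            have := mul_le_mul_of_nonneg_left hquad hE0.le
            simp only
            linarith
        _ = (1 + (η * C) ^ 2) * ∫ ω, E ω ∂μ + η * ∫ ω, E ω * g n ω ∂μ + Real.exp (η * C) := by
            rw [integral_add (f := fun ω => (1 + (η * C) ^ 2) * E ω +
              η * (E ω * (σ n ω * (D (n + 1) ω - D n ω))))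
              ((hI1.const_mul _).add (hI2.const_mul η)) (integrable_const _),
              integral_add (hI1.const_mul _) (hI2.const_mul η), integral_const_mul,
              integral_const_mul, hdrift n E hEn]
            simp [E]
        _ ≤ (1 + (η * C) ^ 2) * ∫ ω, E ω ∂μ + η * ((-δ) * ∫ ω, E ω ∂μ) + Real.exp (η * C) := by
            have : ∫ ω, E ω * g n ω ∂μ ≤ (-δ) * ∫ ω, E ω ∂μ := by
              rw [← integral_const_mul]
              refine integral_mono hI3 (hI1.const_mul _) fun ω => ?_
              have := mul_le_mul_of_nonneg_left (hgδ n ω) (Real.exp_nonneg (η * |D n ω|))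
              simp only [E]; linarith
            have := mul_le_mul_of_nonneg_left this hη.le
            linarith
        _ ≤ (1 - x) * ∫ ω, E ω ∂μ + Real.exp (η * C) := by
            have h0 : 0 ≤ ∫ ω, E ω ∂μ := integral_nonneg fun ω => Real.exp_nonneg _
            have h1 : (η * C) ^ 2 ≤ x := by
              calc (η * C) ^ 2 = η * (η * C ^ 2) := by ring
                _ ≤ η * (δ / 2) := mul_le_mul_of_nonneg_left hη2 hη.le
                _ = x := by rw [hx]; ring
            have h2 := mul_le_mul_of_nonneg_right h1 h0
            rw [hx] at h2 ⊢
            linarith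
        _ ≤ (1 - x) * K + Real.exp (η * C) := by
            have : 0 ≤ 1 - x := by rw [hx]; linarith
            linarith [mul_le_mul_of_nonneg_left ih this]
        _ ≤ K := by
            have : x * K = x + Real.exp (η * C) := by rw [hK]; field_simp
            linarith
  -- Markov's inequality at level `n^2` for the exponential moment is summable in `n`; taking
  -- logarithms of `n^2` gives the constant `2 / η`.
  refine ⟨2 / η, ?_⟩
  let A : ℕ → Set Ω := fun n => {ω | ((n : ℝ) ^ 2) ≤ Real.exp (η * |D n ω|)}
  have hA : ∀ n, 0 < n → μ (A n) ≤ ENNReal.ofReal (K * ((n : ℝ) ^ 2)⁻¹) := by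
    intro n hn
    have hn' : (0 : ℝ) < (n : ℝ) ^ 2 := by positivity
    have h := mul_meas_ge_le_integral_of_nonneg (μ := μ) (f := fun ω => Real.exp (η * |D n ω|))
      (Eventually.of_forall fun ω => Real.exp_nonneg _) ((hE n).integrable (G.le _)) ((n : ℝ) ^ 2)
    rw [← ofReal_measureReal]
    refine ENNReal.ofReal_le_ofReal ?_
    rw [← div_eq_mul_inv, le_div_iff₀ hn']
    have := hmom n
    simp only [A]
    linarith
  have hsum : ∑' n, μ (A (n + 1)) ≠ ⊤ := by
    have hs : Summable fun n : ℕ => K * ((n : ℝ) ^ 2)⁻¹ :=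
      (Real.summable_nat_pow_inv.2 one_lt_two).mul_left K
    have hs' := (summable_nat_add_iff 1).2 hs
    exact ne_top_of_le_ne_top hs'.tsum_ofReal_ne_top
      (ENNReal.tsum_le_tsum fun n => hA (n + 1) n.succ_pos)
  filter_upwards [ae_eventually_notMem hsum] with ω hω
  obtain ⟨N, hN⟩ := eventually_atTop.1 hω
  filter_upwards [eventually_ge_atTop (N + 1)] with n hn
  have h1 := hN (n - 1) (by omega)
  rw [Nat.sub_add_cancel (by omega)] at h1
  have hn' : (0 : ℝ) < n := by exact_mod_cast (by omega : 0 < n)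
  have h2 : Real.exp (η * |D n ω|) < (n : ℝ) ^ 2 := not_le.1 h1
  have h3 := (Real.lt_log_iff_exp_lt (by positivity)).2 h2
  rw [Real.log_pow] at h3
  rw [div_mul_eq_mul_div, le_div_iff₀ hη]
  push_cast at h3
  linarith

end Drift

/-! ### Debts as martingales plus idle time -/

section Decomposition

lemma sum_range_mul {M : Type*} [AddCommMonoid M] {τ : ℕ} (hτ : 0 < τ) (F : ℕ → ℕ → M) (t : ℕ) :
    ∑ n ∈ Finset.range (t * τ), F (n / τ) (n % τ) =
      ∑ k ∈ Finset.range t, ∑ s ∈ Finset.range τ, F k s := by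
  induction t with
  | zero => simp
  | succ t ih =>
    rw [Nat.succ_mul, Finset.sum_range_add, ih, Finset.sum_range_succ]
    congr 1
    refine Finset.sum_congr rfl fun s hs => ?_
    have hs := Finset.mem_range.1 hs
    rw [Nat.mul_comm, Nat.mul_add_div hτ, Nat.div_eq_of_lt hs, Nat.mul_add_mod,
      Nat.mod_eq_of_lt hs, add_zero]

variable {Ω : Type*} {mΩ : MeasurableSpace Ω} {μ : Measure Ω}
  {ℱ : Filtration ℕ mΩ} {τ : ℕ} {p : Fin 2 → unitInterval} {q : Fin 2 → ℝ}
  {first : ℕ → Ω → Fin 2} {success : ℕ → Ω → Bool}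

/-- The centred number of deliveries, in units of transmissions, in a slot. -/
noncomputable def noise (τ : ℕ) (p : Fin 2 → unitInterval) (first : ℕ → Ω → Fin 2)
    (success : ℕ → Ω → Bool) (j : Fin 2) (k s : ℕ) (ω : Ω) : ℝ :=
  attempt τ first success j k s ω - (p j : ℝ)⁻¹ * delivery τ first success j k s ω

lemma abs_noise_le (j : Fin 2) (k s : ℕ) (ω : Ω) :
    |noise τ p first success j k s ω| ≤ 1 + (p j : ℝ)⁻¹ := by
  have h0 : 0 ≤ (p j : ℝ)⁻¹ := inv_nonneg.2 (p j).2.1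
  refine (abs_sub _ _).trans (add_le_add ?_ ?_)
  · unfold attempt; split_ifs <;> simp
  · rw [abs_mul, abs_of_nonneg h0]
    unfold delivery; split_ifs <;> simp [h0]

lemma IsMWDF.bddMeas_noise (hsys : IsMWDF τ first success μ ℱ p q) (j : Fin 2) (k s : ℕ) :
    BddMeas (ℱ (k * τ + s + 1)) (noise τ p first success j k s) :=
  ((hsys.bddMeas_attempt j k s).mono (ℱ.mono (by omega))).sub
    ((hsys.bddMeas_delivery j k s).const_mul _)

lemma IsMWDF.sameCondMean_noise [IsProbabilityMeasure μ]
    (hsys : IsMWDF τ first success μ ℱ p q) (hp : ∀ j, 0 < p j) (j : Fin 2) (k : ℕ)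
    {s : ℕ} (hs : s < τ) :
    SameCondMean μ (ℱ (k * τ + s)) (noise τ p first success j k s) 0 := by
  have hpj : (p j : ℝ) ≠ 0 := (show (0 : ℝ) < p j from hp j).ne'
  have ha := (hsys.bddMeas_attempt j k s).mono (ℱ.le _)
  have hd := (hsys.bddMeas_delivery j k s).mono (ℱ.le _)
  refine ((SameCondMean.refl (attempt τ first success j k s)).add (ℱ.le _) ha ha
    (hd.const_mul _) ((ha.const_mul _).const_mul _)
    ((hsys.sameCondMean_delivery j k hs).mul_left (bddMeas_const (-(p j : ℝ)⁻¹)))).congr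
    (fun ω => ?_) (fun ω => ?_)
  · simp only [noise]; ring
  · simp only [Pi.zero_apply]; field_simp; ring

lemma IsMWDF.sameCondMean_noise_sq [IsProbabilityMeasure μ]
    (hsys : IsMWDF τ first success μ ℱ p q) (hp : ∀ j, 0 < p j) (j : Fin 2) (k : ℕ)
    {s : ℕ} (hs : s < τ) :
    SameCondMean μ (ℱ (k * τ + s)) (fun ω => noise τ p first success j k s ω ^ 2)
      (fun ω => (1 - p j) / p j * attempt τ first success j k s ω) := by
  have hpj : (p j : ℝ) ≠ 0 := (show (0 : ℝ) < p j from hp j).ne'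
  have ha := (hsys.bddMeas_attempt j k s).mono (ℱ.le _)
  have hd := (hsys.bddMeas_delivery j k s).mono (ℱ.le _)
  refine ((SameCondMean.refl (attempt τ first success j k s)).add (ℱ.le _) ha ha
    (hd.const_mul _) ((ha.const_mul _).const_mul _)
    ((hsys.sameCondMean_delivery j k hs).mul_left
      -- Expand `(1 - X / p)^2` on an attempt, using `X^2 = X` for the success indicator `X`.
      (bddMeas_const ((p j : ℝ)⁻¹ ^ 2 - 2 * (p j : ℝ)⁻¹)))).congr
    (fun ω => ?_) (fun ω => ?_)
  · simp only [noise, attempt, delivery]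
    by_cases h : served τ first success k s ω = some j
    · by_cases h' : success (k * τ + s) ω = true
      · simp only [h, h', and_self, if_true]; ring
      · simp [h, h']
    · simp [h]
  · field_simp; ring

lemma idleTime_eq_sum (k : ℕ) (ω : Ω) :
    idleTime τ first success k ω =
      ∑ s ∈ Finset.range τ, if served τ first success k s ω = none then (1 : ℝ) else 0 := by
  simp [idleTime]

lemma sum_attempt (k s : ℕ) (ω : Ω) :
    attempt τ first success 0 k s ω + attempt τ first success 1 k s ω =
      1 - if served τ first success k s ω = none then (1 : ℝ) else 0 := by
  simp only [attempt]
  cases served τ first success k s ω with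
  | none => simp
  | some j => fin_cases j <;> simp

lemma sum_delivery (j : Fin 2) (k : ℕ) (ω : Ω) :
    ∑ s ∈ Finset.range τ, delivery τ first success j k s ω =
      if j ∉ pendingAt τ first success k τ ω then 1 else 0 :=
  sum_success_eq (first k ω) (fun r => success (k * τ + r) ω) j τ

lemma debt_eq (j : Fin 2) (t : ℕ) (ω : Ω) :
    debt τ first success q j t ω = t * q j -
      ∑ k ∈ Finset.range t, ∑ s ∈ Finset.range τ, delivery τ first success j k s ω := by
  simp only [debt, sum_delivery, Finset.sum_boole]

lemma debt_div_eq (hp : ∀ j, 0 < p j) (j : Fin 2) (t : ℕ) (ω : Ω) :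
    debt τ first success q j t ω / p j = t * (q j / p j) +
      ∑ k ∈ Finset.range t, ∑ s ∈ Finset.range τ, noise τ p first success j k s ω -
      ∑ k ∈ Finset.range t, ∑ s ∈ Finset.range τ, attempt τ first success j k s ω := by
  have hpj : (p j : ℝ) ≠ 0 := (show (0 : ℝ) < p j from hp j).ne'
  simp only [debt_eq, noise, Finset.sum_sub_distrib, ← Finset.mul_sum]
  field_simp
  ring

/-- Total attempts are `t * τ` minus total idle time, so the hyperplane equation leaves only the
centred idle time and the noise. -/
lemma debt_add_debt (hp : ∀ j, 0 < p j) {c : ℝ}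
    (hplane : q 0 / (p 0 : ℝ) + q 1 / (p 1 : ℝ) = τ - c) (t : ℕ) (ω : Ω) :
    debt τ first success q 0 t ω / p 0 + debt τ first success q 1 t ω / p 1 =
      ∑ k ∈ Finset.range t, (idleTime τ first success k ω - c) +
      ∑ k ∈ Finset.range t, ∑ s ∈ Finset.range τ, noise τ p first success 0 k s ω +
      ∑ k ∈ Finset.range t, ∑ s ∈ Finset.range τ, noise τ p first success 1 k s ω := by
  rw [debt_div_eq hp, debt_div_eq hp]
  have h : ∑ k ∈ Finset.range t, ∑ s ∈ Finset.range τ, attempt τ first success 0 k s ω +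
      ∑ k ∈ Finset.range t, ∑ s ∈ Finset.range τ, attempt τ first success 1 k s ω =
      t * τ - ∑ k ∈ Finset.range t, idleTime τ first success k ω := by
    simp only [← Finset.sum_add_distrib, sum_attempt, idleTime_eq_sum, Finset.sum_sub_distrib,
      Finset.sum_const, Finset.card_range, nsmul_eq_mul, mul_one]
  have h2 : (t : ℝ) * (q 0 / p 0) + t * (q 1 / p 1) = t * (τ - c) := by rw [← mul_add, hplane]
  rw [Finset.sum_sub_distrib, Finset.sum_const, Finset.card_range, nsmul_eq_mul]
  linarith

end Decomposition

/-! ### Conditional means over a frame and state space collapse -/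

section FrameMeans

variable {Ω : Type*} {mΩ : MeasurableSpace Ω} {μ : Measure Ω}
  {ℱ : Filtration ℕ mΩ} {τ : ℕ} {p : Fin 2 → unitInterval} {q : Fin 2 → ℝ}
  {first : ℕ → Ω → Fin 2} {success : ℕ → Ω → Bool}

lemma idleTime_eq_count (k : ℕ) (ω : Ω) :
    idleTime τ first success k ω = ((∑ i ∈ Finset.range τ,
      if pendingAt τ first success k (0 + i) ω ∩ Finset.univ = ∅ then 1 else 0 : ℕ) : ℝ) := by
  rw [idleTime_eq_sum]
  push_cast
  refine Finset.sum_congr rfl fun i _ => ?_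
  simp only [served, target_eq_none_iff, zero_add, Finset.inter_univ]

lemma exists_target_inter_univ (f : Fin 2) (A : Finset (Fin 2)) :
    A ∩ Finset.univ ≠ ∅ → ∃ j ∈ A ∩ Finset.univ, target f A = some j := by
  revert f A; decide

lemma exists_target_inter_singleton (f : Fin 2) (A : Finset (Fin 2)) :
    A ∩ {f} ≠ ∅ → ∃ j ∈ A ∩ {f}, target f A = some j := by
  revert f A; decide

/-- The idle time of a frame is independent of the past. -/
lemma IsMWDF.sameCondMean_idleTime [IsProbabilityMeasure μ]
    (hsys : IsMWDF τ first success μ ℱ p q) (hp : ∀ j, 0 < p j)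
    (k : ℕ) (h : ℝ → ℝ) :
    SameCondMean μ (ℱ (k * τ)) (fun ω => h (idleTime τ first success k ω))
      (fun _ => idleMean p (fun n => h n) Finset.univ τ) :=
  (hsys.sameCondMean_count hp k (T := fun _ => Finset.univ) exists_target_inter_univ
    (fun n => h n)).congr (fun ω => by rw [idleTime_eq_count]) fun _ => rfl

lemma IsMWDF.bddMeas_idleTime (hsys : IsMWDF τ first success μ ℱ p q) (k : ℕ) :
    BddMeas (ℱ ((k + 1) * τ)) (idleTime τ first success k) := by
  rw [funext (idleTime_eq_sum (τ := τ) (first := first) (success := success) k)]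
  refine BddMeas.sum _ fun s hs => ?_
  have hs := Finset.mem_range.1 hs
  exact (hsys.bddMeas_state k s fun f A => if target f A = none then (1 : ℝ) else 0).mono
    (ℱ.mono (by rw [add_mul]; omega))

lemma IsMWDF.integral_idleTime [IsProbabilityMeasure μ]
    (hsys : IsMWDF τ first success μ ℱ p q) (hp : ∀ j, 0 < p j)
    (k : ℕ) (h : ℝ → ℝ) :
    ∫ ω, h (idleTime τ first success k ω) ∂μ = idleMean p (fun n => h n) Finset.univ τ := by
  simpa using hsys.sameCondMean_idleTime hp k h _ (bddMeas_const 1)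

lemma IsMWDF.variance_idleTime [IsProbabilityMeasure μ]
    (hsys : IsMWDF τ first success μ ℱ p q) (hp : ∀ j, 0 < p j)
    (k : ℕ) :
    Var[idleTime τ first success k; μ] = idleMean p
      (fun n => ((n : ℝ) - idleMean p (fun n => (n : ℝ)) Finset.univ τ) ^ 2) Finset.univ τ := by
  rw [variance_eq_integral ((hsys.bddMeas_idleTime k).1.mono (ℱ.le _) le_rfl).aemeasurable]
  have h := hsys.integral_idleTime hp k id
  simp only [id] at h
  rw [h]
  exact hsys.integral_idleTime hp k
    fun x => (x - idleMean p (fun n => (n : ℝ)) Finset.univ τ) ^ 2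

lemma IsMWDF.sameCondMean_frame_noise [IsProbabilityMeasure μ]
    (hsys : IsMWDF τ first success μ ℱ p q)
    (hp : ∀ j, 0 < p j) (j : Fin 2) (k : ℕ) :
    SameCondMean μ (ℱ (k * τ))
      (fun ω => ∑ s ∈ Finset.range τ, noise τ p first success j k s ω) (fun _ => 0) := by
  refine (SameCondMean.sum (H := fun _ _ => 0) (ℱ.le _) (Finset.range τ)
    (fun s _ => (hsys.bddMeas_noise j k s).mono (ℱ.le _)) (fun s _ => bddMeas_const 0)
    fun s hs => ?_).congr (fun _ => rfl) fun _ => by simp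
  exact (hsys.sameCondMean_noise hp j k (Finset.mem_range.1 hs)).mono (ℱ.mono (by omega))

/-- The difference of the weighted debts. -/
noncomputable def debtGap (τ : ℕ) (p : Fin 2 → unitInterval) (q : Fin 2 → ℝ)
    (first : ℕ → Ω → Fin 2) (success : ℕ → Ω → Bool) (t : ℕ) (ω : Ω) : ℝ :=
  debt τ first success q 0 t ω / p 0 - debt τ first success q 1 t ω / p 1

/-- The sign that makes the difference of the weighted debts nonnegative. -/
noncomputable def prioritySign (f : Fin 2) : ℝ := if f = 0 then 1 else -1

lemma debtGap_succ_sub (hp : ∀ j, 0 < p j) (k : ℕ) (ω : Ω) :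
    debtGap τ p q first success (k + 1) ω - debtGap τ p q first success k ω =
      (q 0 / p 0 - q 1 / p 1) +
      (∑ s ∈ Finset.range τ, noise τ p first success 0 k s ω -
        ∑ s ∈ Finset.range τ, noise τ p first success 1 k s ω) -
      ∑ s ∈ Finset.range τ,
        (attempt τ first success 0 k s ω - attempt τ first success 1 k s ω) := by
  simp only [debtGap, debt_div_eq hp, Finset.sum_range_succ, Finset.sum_sub_distrib]
  push_cast
  ring

/-- If `N` slots are not given to the priority client and `I` are idle, that client gets `τ - N`
attempts and the other one `N - I`. -/
lemma prioritySign_mul_sum (k : ℕ) (ω : Ω) :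
    prioritySign (first k ω) * ∑ s ∈ Finset.range τ,
        (attempt τ first success 0 k s ω - attempt τ first success 1 k s ω) =
      τ - 2 * ((∑ i ∈ Finset.range τ,
        if pendingAt τ first success k (0 + i) ω ∩ {first k ω} = ∅ then 1 else 0 : ℕ) : ℝ) +
      idleTime τ first success k ω := by
  have aux : ∀ (f : Fin 2) (A : Finset (Fin 2)), prioritySign f *
      ((if target f A = some 0 then 1 else 0) - (if target f A = some 1 then 1 else 0)) =
      1 - 2 * (if A ∩ {f} = ∅ then 1 else 0) + if target f A = none then (1 : ℝ) else 0 := by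
    intro f A
    have e : A ∩ {f} = ∅ ↔ target f A ≠ some f := by revert f A; decide
    simp only [e]
    rcases target f A with _ | j
    · simp; norm_num
    · fin_cases f <;> fin_cases j <;> simp [prioritySign] <;> norm_num
  have h : ∀ s, prioritySign (first k ω) *
      (attempt τ first success 0 k s ω - attempt τ first success 1 k s ω) =
      1 - 2 * (if pendingAt τ first success k (0 + s) ω ∩ {first k ω} = ∅ then 1 else 0) +
        if served τ first success k s ω = none then (1 : ℝ) else 0 := by
    intro s
    simp only [attempt, served, zero_add]
    exact aux _ _
  rw [Finset.mul_sum, Finset.sum_congr rfl fun s _ => h s, idleTime_eq_sum]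
  push_cast
  rw [Finset.sum_add_distrib, Finset.sum_sub_distrib, Finset.mul_sum]
  simp

/-- The noise averages out. The hyperplane equation eliminates both the mean idle time and the other
client's rate, leaving twice the excess of the priority client's required attempts over its mean
attempts. -/
lemma IsMWDF.sameCondMean_debtGap [IsProbabilityMeasure μ]
    (hsys : IsMWDF τ first success μ ℱ p q)
    (hp : ∀ j, 0 < p j) (hplane : q 0 / (p 0 : ℝ) + q 1 / (p 1 : ℝ) =
      τ - idleMean p (fun n => (n : ℝ)) Finset.univ τ) (k : ℕ) :
    SameCondMean μ (ℱ (k * τ))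
      (fun ω => prioritySign (first k ω) *
        (debtGap τ p q first success (k + 1) ω - debtGap τ p q first success k ω))
      (fun ω => 2 * (q (first k ω) / p (first k ω) -
        (τ - idleMean p (fun n => (n : ℝ)) {first k ω} τ))) := by
  have hX := fun j => hsys.sameCondMean_frame_noise hp j k
  have hXb : ∀ j, BddMeas mΩ (fun ω => ∑ s ∈ Finset.range τ, noise τ p first success j k s ω) :=
    fun j => BddMeas.sum _ fun s _ => (hsys.bddMeas_noise j k s).mono (ℱ.le _)
  have hf := hsys.bddMeas_first k
  have hf' := fun h => (hf h).mono (ℱ.le _)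
  have hN := hsys.sameCondMean_count hp k (T := fun f => {f}) exists_target_inter_singleton
    (fun n => (n : ℝ))
  have hNb := hsys.bddMeas_count k (fun f => {f}) (fun n => (n : ℝ)) τ 0
  have hI := hsys.sameCondMean_idleTime hp k id
  have hIb := (hsys.bddMeas_idleTime k).mono (ℱ.le _)
  have h0 := SameCondMean.refl (μ := μ) (m := ℱ (k * τ))
    fun ω => prioritySign (first k ω) * (q 0 / p 0 - q 1 / p 1) - τ
  have hb0 := hf' fun f => prioritySign f * (q 0 / p 0 - q 1 / p 1) - τ
  have hs := hf prioritySign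
  have hs' := hf' prioritySign
  have h1 := h0.add (ℱ.le _) hb0 hb0 (hs'.mul (hXb 0)) (hs'.mul (bddMeas_const 0))
    ((hX 0).mul_left hs)
  have hb1 := hb0.add (hs'.mul (hXb 0))
  have hb1' := hb0.add (hs'.mul (bddMeas_const 0))
  have h2 := h1.add (ℱ.le _) hb1 hb1' (hs'.neg.mul (hXb 1)) (hs'.neg.mul (bddMeas_const 0))
    ((hX 1).mul_left hs.neg)
  have hb2 := hb1.add (hs'.neg.mul (hXb 1))
  have hb2' := hb1'.add (hs'.neg.mul (bddMeas_const 0))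
  have hc := hf' fun f => idleMean p (fun n => (n : ℝ)) {f} τ
  have h3 := h2.add (ℱ.le _) hb2 hb2' (hNb.const_mul 2) (hc.const_mul 2)
    (hN.mul_left (bddMeas_const 2))
  have hb3 := hb2.add (hNb.const_mul 2)
  have hb3' := hb2'.add (hc.const_mul 2)
  have h4 := h3.add (ℱ.le _) hb3 hb3' (hIb.const_mul (-1)) ((bddMeas_const _).const_mul (-1))
    (hI.mul_left (bddMeas_const (-1)))
  refine h4.congr (fun ω => ?_) (fun ω => ?_)
  · have := prioritySign_mul_sum (τ := τ) (first := first) (success := success) k ω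
    rw [debtGap_succ_sub hp, mul_sub, this]
    ring
  · generalize first k ω = f
    fin_cases f <;> simp [prioritySign] <;> linarith

/-- State space collapse: the weighted debts differ by `O(log t)`. -/
lemma IsMWDF.eventually_abs_debtGap_le [IsProbabilityMeasure μ]
    (hsys : IsMWDF τ first success μ ℱ p q)
    (hp : ∀ j, 0 < p j) (hplane : q 0 / (p 0 : ℝ) + q 1 / (p 1 : ℝ) =
      τ - idleMean p (fun n => (n : ℝ)) Finset.univ τ)
    (hlt : ∀ j, q j / (p j : ℝ) < τ - idleMean p (fun n => (n : ℝ)) {j} τ) :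
    ∃ K : ℝ, ∀ᵐ ω ∂μ, ∀ᶠ t : ℕ in atTop,
      |debtGap τ p q first success t ω| ≤ K * Real.log t := by
  let G : Filtration ℕ mΩ :=
    ⟨fun n => ℱ (n * τ), fun i j h => ℱ.mono (Nat.mul_le_mul_right τ h), fun n => ℱ.le _⟩
  let gap : Fin 2 → ℝ := fun j => τ - idleMean p (fun n => (n : ℝ)) {j} τ - q j / (p j : ℝ)
  have hdebt : ∀ j t, BddMeas (G t) (fun ω => debt τ first success q j t ω / p j) := by
    intro j t
    simp only [debt_eq, div_eq_inv_mul]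
    refine BddMeas.const_mul ((bddMeas_const _).sub (BddMeas.sum _ fun k hk =>
      BddMeas.sum _ fun s hs => (hsys.bddMeas_delivery j k s).mono (ℱ.mono ?_))) _
    have hk := Finset.mem_range.1 hk
    have hs := Finset.mem_range.1 hs
    calc k * τ + s + 1 ≤ (k + 1) * τ := by rw [add_mul]; omega
      _ ≤ t * τ := Nat.mul_le_mul_right τ hk
  refine eventually_abs_le_log_of_drift (G := G) (D := debtGap τ p q first success)
    (σ := fun k ω => prioritySign (first k ω))
    (g := fun k ω => 2 * (q (first k ω) / p (first k ω) -
        (τ - idleMean p (fun n => (n : ℝ)) {first k ω} τ)))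
    (C := |q 0 / p 0 - q 1 / p 1| + (τ * (1 + (p 0 : ℝ)⁻¹) + τ * (1 + (p 1 : ℝ)⁻¹)) + τ * 2)
    (δ := min (gap 0) (gap 1))
    (fun n => (hdebt 0 n).sub (hdebt 1 n)) (fun ω => by simp [debtGap, debt])
    (fun k ω => ?_) (fun k => hsys.bddMeas_first k _) (fun k ω => ?_) (fun k ω => ?_)
    (fun k => hsys.bddMeas_first k fun f => 2 * (q f / p f -
        (τ - idleMean p (fun n => (n : ℝ)) {f} τ))) ?_ (fun k ω => ?_)
    (fun k => hsys.sameCondMean_debtGap hp hplane k)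
  · rw [debtGap_succ_sub hp]
    have hsum : ∀ (F : ℕ → ℝ) (c : ℝ), (∀ s, |F s| ≤ c) → |∑ s ∈ Finset.range τ, F s| ≤ τ * c := by
      intro F c hF
      refine (Finset.abs_sum_le_sum_abs _ _).trans ?_
      refine (Finset.sum_le_card_nsmul _ _ c fun s _ => hF s).trans ?_
      simp
    refine (abs_sub _ _).trans (add_le_add ((abs_add_le _ _).trans (add_le_add le_rfl
      ((abs_sub _ _).trans (add_le_add (hsum _ _ fun s => abs_noise_le 0 k s ω)
        (hsum _ _ fun s => abs_noise_le 1 k s ω))))) (hsum _ _ fun s => ?_))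
    simp only [attempt]
    split_ifs <;> norm_num
  · simp only [prioritySign]
    split_ifs <;> simp
  -- The largest-debt rule is used only here: the sign determined by the priority client agrees with
  -- the sign of the gap.
  · have h := hsys.max_debt k ω
    simp only [prioritySign, debtGap]
    generalize first k ω = f at h
    fin_cases f
    · simpa using h 1
    · simpa using h 0
  · exact lt_min (sub_pos.2 (hlt 0)) (sub_pos.2 (hlt 1))
  · have hpos := fun j => sub_pos.2 (hlt j)
    have h : min (gap 0) (gap 1) ≤ gap (first k ω) := by
      generalize first k ω = f
      fin_cases f
      · exact min_le_left _ _
      · exact min_le_right _ _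
    have := hpos (first k ω)
    simp only [gap] at h ⊢
    linarith

end FrameMeans

/-! ### Growth of the normalization `phi` -/

section Asymptotics

lemma tendsto_log_log_natCast :
    Tendsto (fun t : ℕ => Real.log (Real.log (t : ℝ))) atTop atTop :=
  Real.tendsto_log_atTop.comp (Real.tendsto_log_atTop.comp tendsto_natCast_atTop_atTop)

lemma eventually_sqrt_le_phi : ∀ᶠ t : ℕ in atTop, √(t : ℝ) ≤ phi t := by
  filter_upwards [tendsto_log_log_natCast.eventually_ge_atTop 1] with t ht
  refine Real.sqrt_le_sqrt ?_
  have : (0 : ℝ) ≤ t := Nat.cast_nonneg t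
  nlinarith

lemma eventually_phi_pos : ∀ᶠ t : ℕ in atTop, 0 < phi t := by
  filter_upwards [eventually_sqrt_le_phi, eventually_gt_atTop 0] with t h ht
  exact (Real.sqrt_pos.2 (by exact_mod_cast ht)).trans_le h

lemma eventually_log_le {ε : ℝ} (hε : 0 < ε) :
    ∀ᶠ t : ℕ in atTop, Real.log (t : ℝ) ≤ ε * t := by
  have h := (Real.isLittleO_log_id_atTop.bound hε).natCast_atTop
  filter_upwards [h] with t ht
  have := (le_abs_self _).trans ht
  simpa using this

lemma eventually_log_le_phi {ε : ℝ} (hε : 0 < ε) :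
    ∀ᶠ t : ℕ in atTop, Real.log (t : ℝ) ≤ ε * phi t := by
  have h := ((isLittleO_log_rpow_atTop (r := 1 / 2) (by norm_num)).bound hε).natCast_atTop
  filter_upwards [h, eventually_sqrt_le_phi] with t ht hphi
  have h1 := (le_abs_self _).trans ht
  rw [← Real.sqrt_eq_rpow, Real.norm_of_nonneg (Real.sqrt_nonneg _)] at h1
  exact h1.trans (mul_le_mul_of_nonneg_left hphi hε.le)

lemma eventually_phi_le {ε : ℝ} (hε : 0 < ε) : ∀ᶠ t : ℕ in atTop, phi t ≤ ε * t := by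
  filter_upwards [eventually_log_le (ε := ε ^ 2 / 2) (by positivity),
    (Real.tendsto_log_atTop.comp (tendsto_natCast_atTop_atTop (R := ℝ))).eventually_gt_atTop 0]
    with t ht hlog
  simp only [Function.comp_apply] at hlog
  have h0 : (0 : ℝ) ≤ t := Nat.cast_nonneg t
  refine (Real.sqrt_le_left (by positivity)).2 ?_
  have h1 : Real.log (Real.log t) ≤ ε ^ 2 / 2 * t := by
    have := Real.log_le_sub_one_of_pos hlog
    linarith
  have := mul_le_mul_of_nonneg_left h1 (by positivity : 0 ≤ 2 * (t : ℝ))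
  linarith

/-- `lil_upper` needs a positive variance rate, whereas the true one may vanish (for instance when
`p j = 1`). A slightly larger `b`, and `θ` close to 1, cost only `ε` by continuity. -/
lemma exists_sq_mul_sqrt_le (c : ℝ) {ε : ℝ} (hε : 0 < ε) :
    ∃ b θ : ℝ, 0 < b ∧ c < b ∧ 1 < θ ∧ θ ^ 2 * √b ≤ √c + ε := by
  have hcont : Continuous fun x : ℝ => (1 + x) ^ 2 * √(max c 0 + x) := by fun_prop
  have h0 : (1 + (0 : ℝ)) ^ 2 * √(max c 0 + 0) < √c + ε := by
    rcases le_total 0 c with h | h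
    · rw [max_eq_left h]; simpa using hε
    · rw [max_eq_right h, Real.sqrt_eq_zero_of_nonpos h]; simpa using hε
  have h1 := (hcont.tendsto 0).eventually_lt_const h0
  have h2 : ∀ᶠ x in nhdsWithin (0 : ℝ) (Set.Ioi 0),
      (1 + x) ^ 2 * √(max c 0 + x) < √c + ε := h1.filter_mono nhdsWithin_le_nhds
  obtain ⟨x, hx, hx0⟩ := (h2.and self_mem_nhdsWithin).exists
  have hx0 : 0 < x := hx0
  exact ⟨max c 0 + x, 1 + x, by linarith [le_max_right c 0], by linarith [le_max_left c 0],
    by linarith, hx.le⟩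

end Asymptotics

/-! ### Iterated logarithm bounds for noise, idle time and debts -/

section Debt

variable {Ω : Type*} {mΩ : MeasurableSpace Ω} {μ : Measure Ω} [IsProbabilityMeasure μ]
  {ℱ : Filtration ℕ mΩ} {τ : ℕ} {p : Fin 2 → unitInterval} {q : Fin 2 → ℝ}
  {first : ℕ → Ω → Fin 2} {success : ℕ → Ω → Bool}

/-- The variance rate `b` is left as a hypothesis because the lemma serves twice: with the crude
rate and then with the sharp one. The sign `c` gives two-sided bounds. -/
lemma IsMWDF.noise_lil (hsys : IsMWDF τ first success μ ℱ p q) (hτ : 0 < τ)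
    (hp : ∀ j, 0 < p j) (j : Fin 2) {c : ℝ} (hc : c ^ 2 = 1) {b : ℝ} (hb : 0 < b)
    (hV : ∀ᵐ ω ∂μ, ∀ᶠ t : ℕ in atTop, (1 - p j) / p j *
      ∑ k ∈ Finset.range t, ∑ s ∈ Finset.range τ, attempt τ first success j k s ω ≤ b * t)
    {θ : ℝ} (hθ : 1 < θ) :
    ∀ᵐ ω ∂μ, ∀ᶠ t : ℕ in atTop,
      c * ∑ k ∈ Finset.range t, ∑ s ∈ Finset.range τ, noise τ p first success j k s ω ≤
        θ ^ 2 * √b * phi t := by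
  have hdiv : ∀ n, n / τ * τ + n % τ = n := fun n => Nat.div_add_mod' n τ
  have hmod : ∀ n, n % τ < τ := fun n => Nat.mod_lt n hτ
  have hnoise : ∀ n, BddMeas (ℱ (n + 1)) (noise τ p first success j (n / τ) (n % τ)) := by
    intro n
    have := hsys.bddMeas_noise j (n / τ) (n % τ)
    rwa [hdiv] at this
  have hatt : ∀ n, BddMeas (ℱ n) (attempt τ first success j (n / τ) (n % τ)) := by
    intro n
    have := hsys.bddMeas_attempt j (n / τ) (n % τ)
    rwa [hdiv] at this
  have h := lil_upper (μ := μ) (G := ℱ) (C := 1 + (p j : ℝ)⁻¹) (τ := τ) (b := b) (θ := θ)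
    (ξ := fun n ω => c * noise τ p first success j (n / τ) (n % τ) ω)
    (v := fun n ω => (1 - p j) / p j * attempt τ first success j (n / τ) (n % τ) ω)
    (fun n => ((hnoise n).const_mul c).1) (fun n ω => ?_) (fun n => (hatt n).const_mul _)
    (fun n => ?_) (fun n => ?_) hb ?_ hθ
  · filter_upwards [h] with ω h
    filter_upwards [h] with t h
    rw [sum_range_mul hτ fun k s => c * noise τ p first success j k s ω] at h
    simpa only [Finset.mul_sum] using h
  · have hc' : |c| = 1 := by rw [← sq_eq_sq₀ (abs_nonneg _) zero_le_one, sq_abs, hc, one_pow]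
    rw [abs_mul, hc', one_mul]
    exact abs_noise_le j _ _ ω
  · have := hsys.sameCondMean_noise hp j (n / τ) (hmod n)
    rw [hdiv] at this
    exact (this.mul_left (bddMeas_const c)).congr (fun _ => rfl) fun _ => by simp
  · have := hsys.sameCondMean_noise_sq hp j (n / τ) (hmod n)
    rw [hdiv] at this
    exact this.congr (fun ω => by rw [mul_pow, hc, one_mul]) fun _ => rfl
  · filter_upwards [hV] with ω hV
    filter_upwards [hV] with t hV
    rw [sum_range_mul hτ fun k s => (1 - (p j : ℝ)) / p j * attempt τ first success j k s ω]
    simpa only [Finset.mul_sum] using hV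

lemma IsMWDF.idle_lil (hsys : IsMWDF τ first success μ ℱ p q)
    (hp : ∀ j, 0 < p j) (m : ℕ) {c : ℝ} (hc : c ^ 2 = 1) {b : ℝ} (hb : 0 < b)
    (hV : Var[idleTime τ first success m; μ] ≤ b) {θ : ℝ} (hθ : 1 < θ) :
    ∀ᵐ ω ∂μ, ∀ᶠ t : ℕ in atTop,
      c * ∑ k ∈ Finset.range t, (idleTime τ first success k ω -
        idleMean p (fun n => (n : ℝ)) Finset.univ τ) ≤ θ ^ 2 * √b * phi t := by
  set a := idleMean p (fun n => (n : ℝ)) Finset.univ τ with ha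
  rw [hsys.variance_idleTime hp m] at hV
  let G : Filtration ℕ mΩ :=
    ⟨fun n => ℱ (n * τ), fun i j h => ℱ.mono (Nat.mul_le_mul_right τ h), fun n => ℱ.le _⟩
  have hc' : |c| = 1 := by rw [← sq_eq_sq₀ (abs_nonneg _) zero_le_one, sq_abs, hc, one_pow]
  have h := lil_upper (μ := μ) (G := G) (C := τ + |a|) (τ := 1) (b := b) (θ := θ)
    (ξ := fun k ω => c * (idleTime τ first success k ω - a))
    (v := fun _ _ => idleMean p (fun n => ((n : ℝ) - a) ^ 2) Finset.univ τ)
    (fun k => (((hsys.bddMeas_idleTime k).sub (bddMeas_const a)).const_mul c).1) (fun k ω => ?_)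
    (fun k => bddMeas_const _) (fun k => ?_) (fun k => ?_) hb ?_ hθ
  · simpa only [mul_one, Finset.mul_sum] using h
  · rw [abs_mul, hc', one_mul]
    refine (abs_sub _ _).trans (add_le_add ?_ le_rfl)
    rw [idleTime, Nat.abs_cast, Nat.cast_le]
    exact (Finset.card_filter_le _ _).trans (by simp)
  · have h1 := hsys.sameCondMean_idleTime hp k id
    have hb := (hsys.bddMeas_idleTime k).mono (ℱ.le _)
    have h2 := h1.add (ℱ.le _) hb (bddMeas_const _) (bddMeas_const (-a)) (bddMeas_const (-a))
      (SameCondMean.refl _)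
    refine (h2.mul_left (bddMeas_const c)).congr (fun ω => ?_) fun ω => ?_
    · simp [sub_eq_add_neg]
    · simp [ha]
  · exact (hsys.sameCondMean_idleTime hp k fun x => (x - a) ^ 2).congr
      (fun ω => by rw [mul_pow, hc, one_mul]) fun _ => rfl
  · refine Eventually.of_forall fun ω => Eventually.of_forall fun t => ?_
    simp only [mul_one, Finset.sum_const, Finset.card_range, nsmul_eq_mul]
    rw [mul_comm]
    exact mul_le_mul_of_nonneg_right hV (Nat.cast_nonneg t)

lemma one_sub_div_nonneg (x : unitInterval) : 0 ≤ (1 - (x : ℝ)) / x :=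
  div_nonneg (sub_nonneg.2 x.2.2) x.2.1

/-- The crude round: at most `τ` attempts per frame. The added 1 keeps the rate positive, and `θ =
2` suffices. -/
lemma IsMWDF.exists_abs_noise_le (hsys : IsMWDF τ first success μ ℱ p q) (hτ : 0 < τ)
    (hp : ∀ j, 0 < p j) (j : Fin 2) :
    ∃ K : ℝ, ∀ᵐ ω ∂μ, ∀ᶠ t : ℕ in atTop,
      |∑ k ∈ Finset.range t, ∑ s ∈ Finset.range τ, noise τ p first success j k s ω| ≤
        K * phi t := by
  have h0 := one_sub_div_nonneg (p j)
  have hb : 0 < (1 - (p j : ℝ)) / p j * τ + 1 := by positivity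
  have hV : ∀ᵐ ω ∂μ, ∀ᶠ t : ℕ in atTop, (1 - p j) / p j *
      ∑ k ∈ Finset.range t, ∑ s ∈ Finset.range τ, attempt τ first success j k s ω ≤
      ((1 - (p j : ℝ)) / p j * τ + 1) * t := by
    refine Eventually.of_forall fun ω => Eventually.of_forall fun t => ?_
    have h : ∑ k ∈ Finset.range t, ∑ s ∈ Finset.range τ, attempt τ first success j k s ω ≤
        t * τ := by
      refine (Finset.sum_le_card_nsmul _ _ (τ : ℝ) fun k _ => ?_).trans (by simp)
      refine (Finset.sum_le_card_nsmul _ _ 1 fun s _ => ?_).trans (by simp)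
      simp only [attempt]
      split_ifs <;> norm_num
    have := mul_le_mul_of_nonneg_left h h0
    have : (0 : ℝ) ≤ t := Nat.cast_nonneg t
    linarith
  refine ⟨2 ^ 2 * √((1 - (p j : ℝ)) / p j * τ + 1), ?_⟩
  filter_upwards [hsys.noise_lil hτ hp j (c := 1) (by norm_num) hb hV one_lt_two,
    hsys.noise_lil hτ hp j (c := -1) (by norm_num) hb hV one_lt_two] with ω h1 h2
  filter_upwards [h1, h2] with t h1 h2
  exact abs_le'.2 ⟨by simpa using h1, by simpa using h2⟩

lemma IsMWDF.exists_abs_idle_le (hsys : IsMWDF τ first success μ ℱ p q)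
    (hp : ∀ j, 0 < p j) :
    ∃ K : ℝ, ∀ᵐ ω ∂μ, ∀ᶠ t : ℕ in atTop,
      |∑ k ∈ Finset.range t, (idleTime τ first success k ω -
        idleMean p (fun n => (n : ℝ)) Finset.univ τ)| ≤ K * phi t := by
  have hb : 0 < Var[idleTime τ first success 0; μ] + 1 := by
    linarith [variance_nonneg (idleTime τ first success 0) μ]
  refine ⟨2 ^ 2 * √(Var[idleTime τ first success 0; μ] + 1), ?_⟩
  filter_upwards [hsys.idle_lil hp 0 (c := 1) (by norm_num) hb (by linarith) one_lt_two,
    hsys.idle_lil hp 0 (c := -1) (by norm_num) hb (by linarith) one_lt_two] with ω h1 h2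
  filter_upwards [h1, h2] with t h1 h2
  exact abs_le'.2 ⟨by simpa using h1, by simpa using h2⟩

/-- The weighted debts are almost surely not of negative linear order. -/
lemma IsMWDF.eventually_neg_le_debt (hsys : IsMWDF τ first success μ ℱ p q) (hτ : 0 < τ)
    (hp : ∀ j, 0 < p j) (hplane : q 0 / (p 0 : ℝ) + q 1 / (p 1 : ℝ) =
      τ - idleMean p (fun n => (n : ℝ)) Finset.univ τ)
    (hlt : ∀ j, q j / (p j : ℝ) < τ - idleMean p (fun n => (n : ℝ)) {j} τ) (j : Fin 2)
    {ε : ℝ} (hε : 0 < ε) :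
    ∀ᵐ ω ∂μ, ∀ᶠ t : ℕ in atTop, -(ε * t) ≤ debt τ first success q j t ω / p j := by
  obtain ⟨K0, h0⟩ := hsys.exists_abs_noise_le hτ hp 0
  obtain ⟨K1, h1⟩ := hsys.exists_abs_noise_le hτ hp 1
  obtain ⟨K2, h2⟩ := hsys.exists_abs_idle_le hp
  obtain ⟨K3, h3⟩ := hsys.eventually_abs_debtGap_le hp hplane hlt
  have hphi := eventually_phi_le (ε := ε / (|K0 + K1 + K2| + 1)) (by positivity)
  have hlog := eventually_log_le (ε := ε / (|K3| + 1)) (by positivity)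
  filter_upwards [h0, h1, h2, h3] with ω h0 h1 h2 h3
  filter_upwards [h0, h1, h2, h3, hphi, hlog, eventually_phi_pos, eventually_ge_atTop 1]
    with t h0 h1 h2 h3 hphi hlog hpos ht
  have hsum := debt_add_debt (first := first) (success := success) hp hplane t ω
  have key : ∀ K x : ℝ, 0 ≤ x → x ≤ ε / (|K| + 1) * t → K * x ≤ ε * t := by
    intro K x hx hxt
    have hK : 0 ≤ |K| := abs_nonneg K
    calc K * x ≤ |K| * x := mul_le_mul_of_nonneg_right (le_abs_self K) hx
      _ ≤ (|K| + 1) * x := by linarith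
      _ ≤ (|K| + 1) * (ε / (|K| + 1) * t) := mul_le_mul_of_nonneg_left hxt (by positivity)
      _ = ε * t := by field_simp
  have k1 := key _ _ hpos.le hphi
  have k2 := key _ _ (Real.log_nonneg (by exact_mod_cast ht)) hlog
  have a0 := (abs_le.1 h0).1
  have a1 := (abs_le.1 h1).1
  have a2 := (abs_le.1 h2).1
  have a3 := abs_le.1 h3
  simp only [debtGap] at a3
  fin_cases j
  · simp only [Fin.zero_eta]; linarith
  · simp only [Fin.mk_one]; linarith

/-- The sharp round: a debt that is not linearly negative means that attempts do not exceed `q j / p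
j` per frame by a fixed amount, and `(1 - p j) / p j * (q j / p j)` is `c_j`. -/
lemma IsMWDF.noise_lil_sharp (hsys : IsMWDF τ first success μ ℱ p q) (hτ : 0 < τ)
    (hp : ∀ j, 0 < p j) (hplane : q 0 / (p 0 : ℝ) + q 1 / (p 1 : ℝ) =
      τ - idleMean p (fun n => (n : ℝ)) Finset.univ τ)
    (hlt : ∀ j, q j / (p j : ℝ) < τ - idleMean p (fun n => (n : ℝ)) {j} τ) (j : Fin 2)
    {ε : ℝ} (hε : 0 < ε) :
    ∀ᵐ ω ∂μ, ∀ᶠ t : ℕ in atTop,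
      ∑ k ∈ Finset.range t, ∑ s ∈ Finset.range τ, noise τ p first success j k s ω ≤
        (√(cCoef p q j) + ε) * phi t := by
  obtain ⟨b, θ, hb, hcb, hθ, hbθ⟩ := exists_sq_mul_sqrt_le (cCoef p q j) hε
  set κ : ℝ := (1 - (p j : ℝ)) / p j with hκ
  have hκ0 : 0 ≤ κ := one_sub_div_nonneg (p j)
  have hpj : (p j : ℝ) ≠ 0 := (show (0 : ℝ) < p j from hp j).ne'
  -- Chosen so that `κ * δ ≤ b - c_j`, with `κ + 1` in place of `κ` since `κ` may be 0. Half of `δ`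
  -- pays for the debt and half for the noise.
  set δ : ℝ := (b - cCoef p q j) / (κ + 1) with hδ
  have hδ0 : 0 < δ := div_pos (by linarith) (by linarith)
  obtain ⟨K, hK⟩ := hsys.exists_abs_noise_le hτ hp j
  have hV : ∀ᵐ ω ∂μ, ∀ᶠ t : ℕ in atTop, (1 - p j) / p j *
      ∑ k ∈ Finset.range t, ∑ s ∈ Finset.range τ, attempt τ first success j k s ω ≤ b * t := by
    filter_upwards [hK, hsys.eventually_neg_le_debt hτ hp hplane hlt j (half_pos hδ0)]
      with ω hK hw
    filter_upwards [hK, hw, eventually_phi_le (ε := δ / 2 / (|K| + 1)) (by positivity),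
      eventually_phi_pos] with t hK hw hphi hpos
    have hK' : K * phi t ≤ δ / 2 * t := by
      calc K * phi t ≤ (|K| + 1) * phi t :=
            mul_le_mul_of_nonneg_right (by linarith [le_abs_self K]) hpos.le
        _ ≤ (|K| + 1) * (δ / 2 / (|K| + 1) * t) :=
            mul_le_mul_of_nonneg_left hphi (by positivity)
        _ = δ / 2 * t := by field_simp
    have hM := (abs_le.1 hK).2
    rw [debt_div_eq hp] at hw
    have hle : ∑ k ∈ Finset.range t, ∑ s ∈ Finset.range τ, attempt τ first success j k s ω ≤
        (q j / p j + δ) * t := by linarith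
    have h1 := mul_le_mul_of_nonneg_left hle hκ0
    have h2 : κ * (q j / p j) = cCoef p q j := by
      rw [hκ, cCoef]; field_simp
    have h3 : κ * δ ≤ b - cCoef p q j := by
      have : (κ + 1) * δ = b - cCoef p q j := by rw [hδ]; field_simp
      linarith
    calc _ ≤ κ * ((q j / p j + δ) * t) := h1
      _ = (cCoef p q j + κ * δ) * t := by rw [← h2]; ring
      _ ≤ b * t := mul_le_mul_of_nonneg_right (by linarith) (Nat.cast_nonneg t)
  filter_upwards [hsys.noise_lil hτ hp j (c := 1) (by norm_num) hb hV hθ] with ω h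
  filter_upwards [h, eventually_phi_pos] with t h hpos
  rw [one_mul] at h
  exact h.trans (mul_le_mul_of_nonneg_right hbθ hpos.le)

/-- Twice a weighted debt is at most the sum plus the absolute gap. The three martingales and the
gap lose `ε` each, and halving leaves `2 * ε`. -/
lemma IsMWDF.eventually_debt_le (hsys : IsMWDF τ first success μ ℱ p q) (hτ : 0 < τ)
    (hp : ∀ j, 0 < p j) (hplane : q 0 / (p 0 : ℝ) + q 1 / (p 1 : ℝ) =
      τ - idleMean p (fun n => (n : ℝ)) Finset.univ τ)
    (hlt : ∀ j, q j / (p j : ℝ) < τ - idleMean p (fun n => (n : ℝ)) {j} τ) (m : ℕ)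
    {ε : ℝ} (hε : 0 < ε) :
    ∀ᵐ ω ∂μ, ∀ j, ∀ᶠ t : ℕ in atTop, debt τ first success q j t ω / p j ≤
      ((√(cCoef p q 0) + √(cCoef p q 1) + √(Var[idleTime τ first success m; μ])) / 2 + 2 * ε) *
        phi t := by
  obtain ⟨K, hK⟩ := hsys.eventually_abs_debtGap_le hp hplane hlt
  obtain ⟨b, θ, hb, hcb, hθ, hbθ⟩ :=
    exists_sq_mul_sqrt_le (Var[idleTime τ first success m; μ]) hε
  filter_upwards [hK, hsys.noise_lil_sharp hτ hp hplane hlt 0 hε,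
    hsys.noise_lil_sharp hτ hp hplane hlt 1 hε,
    hsys.idle_lil hp m (c := 1) (by norm_num) hb hcb.le hθ] with ω h0 h1 h2 h3 j
  filter_upwards [h0, h1, h2, h3, eventually_log_le_phi (ε := ε / (|K| + 1)) (by positivity),
    eventually_phi_pos, eventually_ge_atTop 1] with t h0 h1 h2 h3 h4 hpos ht
  have hlog : 0 ≤ Real.log t := Real.log_nonneg (by exact_mod_cast ht)
  have hK' : K * Real.log t ≤ ε * phi t := by
    calc K * Real.log t ≤ (|K| + 1) * Real.log t :=
          mul_le_mul_of_nonneg_right (by linarith [le_abs_self K]) hlog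
      _ ≤ (|K| + 1) * (ε / (|K| + 1) * phi t) := mul_le_mul_of_nonneg_left h4 (by positivity)
      _ = ε * phi t := by field_simp
  have h5 := mul_le_mul_of_nonneg_right hbθ hpos.le
  have hsum := debt_add_debt (first := first) (success := success) hp hplane t ω
  have h6 := abs_le.1 h0
  simp only [debtGap] at h6
  rw [one_mul] at h3
  fin_cases j
  · simp only [Fin.zero_eta]; linarith
  · simp only [Fin.mk_one]; linarith

end Debt
end TwoClients

/-! ### The bound on the limsup of the debts -/

theorem mainTheorem3 {Ω : Type*} [MeasurableSpace Ω] (μ : Measure Ω) [IsProbabilityMeasure μ]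
    (ℱ : Filtration ℕ ‹MeasurableSpace Ω›)
    (τ : ℕ) (hτ : 0 < τ)
    (p : Fin 2 → unitInterval) (hp : ∀ j, 0 < p j)
    (q : Fin 2 → ℝ)
    -- `q` is feasible and lies on exactly one of the hyperplanes bounding the rate region,
    -- namely the one of the set of both clients
    (hfeas : TwoClients.IsFeasible τ p q)
    (hplane : q 0 / (p 0 : ℝ) + q 1 / (p 1 : ℝ) =
      (τ : ℝ) * (1 - TwoClients.idleProportion τ p {0, 1}))
    (honly : ∀ j, q j / (p j : ℝ) ≠ (τ : ℝ) * (1 - TwoClients.idleProportion τ p {j}))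
    (first : ℕ → Ω → Fin 2) (success : ℕ → Ω → Bool)
    (hsys : TwoClients.IsMWDF τ first success μ ℱ p q)
    -- `σI` is the standard deviation of the idle time in a frame (in any frame `m`)
    (m : ℕ) (σI : ℝ) (hσI : σI = √(Var[TwoClients.idleTime τ first success m; μ])) :
    ∀ᵐ ω ∂μ, ∀ j : Fin 2,
      limsup (fun t : ℕ =>
          ((TwoClients.debt τ first success q j t ω / TwoClients.phi t : ℝ) : EReal)) atTop ≤
        (((p j : ℝ) * ((√(TwoClients.cCoef p q 0) + √(TwoClients.cCoef p q 1) + σI) / 2) : ℝ) :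
          EReal) := by
  have hτ' : (0 : ℝ) < τ := by exact_mod_cast hτ
  have hpos : ∀ j, (0 : ℝ) < p j := hp
  have huniv : ({0, 1} : Finset (Fin 2)) = Finset.univ := by decide
  have hplane' : q 0 / (p 0 : ℝ) + q 1 / (p 1 : ℝ) =
      τ - TwoClients.idleMean p (fun n => (n : ℝ)) Finset.univ τ := by
    rw [hplane, TwoClients.idleMean_cast hτ, huniv]; ring
  -- Feasibility gives `≤` for singletons, and lying off their hyperplanes makes it strict; this is
  -- the source of the drift.
  have hlt : ∀ j, q j / (p j : ℝ) <
      τ - TwoClients.idleMean p (fun n => (n : ℝ)) {j} τ := by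
    intro j
    rw [TwoClients.idleMean_cast hτ]
    refine lt_of_le_of_ne ?_ fun h => honly j (by rw [h]; ring)
    have h := hfeas {j}
    rw [Finset.sum_singleton, mul_comm (τ : ℝ), ← div_div, div_le_iff₀ hτ'] at h
    linarith
  -- The exceptional null set depends on `ε`, so `ε` is restricted to the countable family `1 / (n +
  -- 1)`.
  have hall : ∀ᵐ ω ∂μ, ∀ n : ℕ, ∀ j, ∀ᶠ t : ℕ in atTop,
      TwoClients.debt τ first success q j t ω / p j ≤
        ((√(TwoClients.cCoef p q 0) + √(TwoClients.cCoef p q 1) + σI) / 2 +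
          2 * (1 / ((n : ℝ) + 1))) * TwoClients.phi t := by
    rw [ae_all_iff]
    intro n
    rw [hσI]
    exact hsys.eventually_debt_le hτ hp hplane' hlt m (by positivity)
  filter_upwards [hall] with ω hω j
  set R : ℝ := (√(TwoClients.cCoef p q 0) + √(TwoClients.cCoef p q 1) + σI) / 2
  have hlim : Tendsto (fun n : ℕ => (((p j : ℝ) * (R + 2 * (1 / ((n : ℝ) + 1))) : ℝ) : EReal))
      atTop (nhds (((p j : ℝ) * R : ℝ) : EReal)) := by
    refine (continuous_coe_real_ereal.tendsto _).comp ?_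
    have := ((tendsto_one_div_add_atTop_nhds_zero_nat (𝕜 := ℝ)).const_mul 2).const_add R
    simpa using this.const_mul (p j : ℝ)
  refine ge_of_tendsto' hlim fun n => limsup_le_of_le (by isBoundedDefault) ?_
  filter_upwards [hω n j, TwoClients.eventually_phi_pos] with t ht hphi
  rw [EReal.coe_le_coe_iff, div_le_iff₀ hphi]
  rw [div_le_iff₀ (hpos j)] at ht
  linarith
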